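/- Setting. Let $T>0$, and let $X=\{x\in\mathbb R^n: g^X_j(x)\ge 0\ \forall j\}$, $X_T=\{x\in\mathbb R^n: g^{X_T}_j(x)\ge 0\ \forall j\}$ and $U=\{u\in\mathbb R^m: g^U_j(u)\ge 0\ \forall j\}$ be compact basic semialgebraic sets (finitely many polynomials each), with $U$ connected. Let $f(t,x,u)\in\mathbb R^n$ be a vector field that is polynomial in $(x,u)$ for each $t\in[0,T]$ and continuous on $[0,T]\times\mathbb R^n\times\mathbb R^m$ (for instance polynomial in $(t,x,u)$). For $v\in\mathbb R[t,x]$ put $\mathcal L v=\partial_t v+\nabla_x v\cdot f$. Splitting. Let $K\ge 2$ and $0=T_1\le T_2\le\dots\le T_K=T$. Each coordinate axis $j$ of the state space is cut at finitely many positions $\rho_{j,1}\le\dots\le\rho_{j,s_j}$. The hyperplanes $x_j=\rho_{j,p}$ cut $X$ into closed subsets $X_i$, the intersections of $X$ with the closed (axis-aligned) grid cells; they are indexed by $i\in\prod_j\{0,\dots,s_j\}$, where $X_i$ consists of those $x\in X$ with $\rho_{j,p}\le x_j$ for $p\le i_j$ and $x_j\le \rho_{j,p}$ for $p>i_j$.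 (If $X$ is a box, the $X_i$ are boxes.) Let $N_X$ be the set of pairs $(a,b)$ of cells with $X_a\cap X_b\neq\emptyset$ such that $b=a+e_j$ for some axis $j$, and let $h_{a,b}=e_j$ be the corresponding normal vector of the common boundary, pointing from $X_a$ to $X_b$. Put $N^{\rm out}_{X_i}=\{b:(i,b)\in N_X\}$ and $N^{\rm in}_{X_i}=\{a:(a,i)\in N_X\}$. Dual LP. Let $d_s^\star=\inf\sum_i\int_{X_i}w_i\,d\lambda$ ($\lambda$ the Lebesgue measure) over all families of polynomials $w_i\in\mathbb R[x]$, $v_{i,k}\in\mathbb R[t,x]$, $1\le k\le K-1$, such that for all $i$, all $k$ and all $(a,b)\in N_X$: - $(\mathcal L v_{i,k})(t,x,u)\le 0$ on $[T_k,T_{k+1}]\times X_i\times U$; - $w_i(x)\ge v_{i,1}(0,x)+1$ and $w_i(x)\ge 0$ on $X_i$; - $v_{i,K-1}(T,x)\ge 0$ on $X_T$; - $v_{i,k}(T_{k+1},x)\ge v_{i,k+1}(T_{k+1},x)$ on $X_i$, for $k\le K-2$; - $(v_{a,k}(t,x)-v_{b,k}(t,x))\,h_{a,b}^\top f(t,x,u)\ge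 0$ on $[T_k,T_{k+1}]\times (X_a\cap X_b)\times U$. Primal LP. Let $p_s^\star=\sup\sum_i\int_{X_i}1\,d\mu^i_{T_1}$ over all families of finite positive Borel measures $\mu^i_k$ on $[T_k,T_{k+1}]\times X_i\times U$ ($1\le k\le K-1$), $\mu^i_{T_k}$ on $X_i$ ($1\le k\le K-1$), $\mu^i_{T_K}$ on $X_T$, $\hat\mu^i_0$ on $X_i$, and $\mu^{a\cap b}_k$ on $[T_k,T_{k+1}]\times(X_a\cap X_b)\times U$ ($(a,b)\in N_X$, $1\le k\le K-1$), such that $\mu^i_{T_1}+\hat\mu^i_0=\lambda|_{X_i}$ for all $i$, and, for all $i$, all $1\le k\le K-1$ and all test polynomials $\Psi\in\mathbb R[t,x]$, $$-\int\mathcal L\Psi\,d\mu^i_k+\int\Psi(T_{k+1},\cdot)\,d\mu^i_{T_{k+1}}-\int\Psi(T_k,\cdot)\,d\mu^i_{T_k}+\sum_{b\in N^{\rm out}_{X_i}}\int (h_{i,b}^\top f)\,\Psi\,d\mu^{i\cap b}_k-\sum_{a\in N^{\rm in}_{X_i}}\int (h_{a,i}^\top f)\,\Psi\,d\mu^{a\cap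 i}_k=0 .$$ Theorem. Assume that $h_{a,b}^\top f(t,x,u)\neq 0$ for all $(a,b)\in N_X$, $t\in[0,T]$, $x\in X_a\cap X_b$ and $u\in U$. Then there is no duality gap: $d_s^\star=p_s^\star$. -/

import Mathlib

open MeasureTheory Set

noncomputable section

/-- The basic semialgebraic set `{x : g₁(x) ≥ 0, …, g_N(x) ≥ 0}`. -/
def basicSemialgebraic {d N : ℕ} (g : Fin N → MvPolynomial (Fin d) ℝ) : Set (Fin d → ℝ) :=
  {x | ∀ j, 0 ≤ MvPolynomial.eval x (g j)}

/-- A point `(t, x)` as an assignment of values to the variables of `ℝ[t, x₁, …, xₙ]`: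
the variable `none` is the time `t`, the variable `some j` is the coordinate `xⱼ`. -/
def timeState {n : ℕ} (t : ℝ) (x : Fin n → ℝ) : Option (Fin n) → ℝ :=
  fun o => o.elim t x

/-- Data of a region-of-attraction problem together with a splitting of time and state space.
There are `numTimes + 2` time nodes, hence `numTimes + 1` time intervals. The `j`-th state axis
is cut at `numSplits j` positions. -/
structure SplitROA (n m : ℕ) where
  /-- the final time -/
  T : ℝ
  T_pos : 0 < T
  /-- the vector field `f(t, x, u)` -/
  f : ℝ → (Fin n → ℝ) → (Fin m → ℝ) → (Fin n → ℝ)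
  /-- `f` is polynomial in `(x, u)` -/
  f_poly : ∀ t ∈ Icc 0 T, ∀ j, ∃ p : MvPolynomial (Fin n ⊕ Fin m) ℝ,
    ∀ x u, f t x u j = MvPolynomial.eval (Sum.elim x u) p
  /-- `f` is continuous (automatic if `f` is also polynomial in `t`) -/
  f_cont : ContinuousOn
    (fun z : ℝ × (Fin n → ℝ) × (Fin m → ℝ) => f z.1 z.2.1 z.2.2) (Icc 0 T ×ˢ univ)
  nX : ℕ
  gX : Fin nX → MvPolynomial (Fin n) ℝ
  nU : ℕ
  gU : Fin nU → MvPolynomial (Fin m) ℝ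
  nXT : ℕ
  gXT : Fin nXT → MvPolynomial (Fin n) ℝ
  /-- the number of interior time splits -/
  numTimes : ℕ
  /-- the time nodes `0 = T₁ ≤ T₂ ≤ … ≤ T_K = T`, `K = numTimes + 2` -/
  time : Fin (numTimes + 2) → ℝ
  time_mono : Monotone time
  time_zero : time 0 = 0
  time_last : time (Fin.last _) = T
  /-- the number of splits of each axis -/
  numSplits : Fin n → ℕ
  /-- the positions of the splits of each axis -/
  split : (j : Fin n) → Fin (numSplits j) → ℝ
  split_mono : ∀ j, Monotone (split j)

namespace SplitROA

variable {n m : ℕ} (P : SplitROA n m)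

/-- The state constraint set. -/
def X : Set (Fin n → ℝ) := basicSemialgebraic P.gX

/-- The control constraint set. -/
def U : Set (Fin m → ℝ) := basicSemialgebraic P.gU

/-- The target set. -/
def XT : Set (Fin n → ℝ) := basicSemialgebraic P.gXT

/-- Indices of the subsets of the state space: `i j` is the position of the subset along the
axis `j`. -/
abbrev Cell : Type := (j : Fin n) → Fin (P.numSplits j + 1)

/-- The subset `X_i` of `X` cut out by the splits: along the axis `j` it lies above the first
`i j` split positions and below the remaining ones. (If `X` is a box, so is `X_i`.) -/
def subset (i : P.Cell) : Set (Fin n → ℝ) :=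
  {x | x ∈ P.X ∧ ∀ (j : Fin n) (p : Fin (P.numSplits j)),
    ((p : ℕ) < (i j : ℕ) → P.split j p ≤ x j) ∧ ((i j : ℕ) ≤ (p : ℕ) → x j ≤ P.split j p)}

/-- The `k`-th time interval `[T_k, T_{k+1}]`. -/
def interval (k : Fin (P.numTimes + 1)) : Set ℝ :=
  Icc (P.time k.castSucc) (P.time k.succ)

/-- The oriented neighbour relation: `X_a` and `X_b` meet, and they are separated by exactly one
splitting hyperplane, with `X_b` on the upper side. -/
def Neighbour (a b : P.Cell) : Prop :=
  (P.subset a ∩ P.subset b).Nonempty ∧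
    ∃ j, (b j : ℕ) = (a j : ℕ) + 1 ∧ ∀ l, l ≠ j → b l = a l

/-- The normal vector `h_{a,b}` of the common boundary of two neighbours, pointing from `X_a`
to `X_b`; it is the unit vector of the axis along which `a` and `b` differ. -/
def normal (a b : P.Cell) : Fin n → ℝ :=
  fun j => if a j < b j then 1 else 0

/-- The normal component `h_{a,b}ᵀ f(t, x, u)` of the vector field. -/
def flux (a b : P.Cell) (t : ℝ) (x : Fin n → ℝ) (u : Fin m → ℝ) : ℝ :=
  ∑ j, P.normal a b j * P.f t x u j

open Classical in
/-- Indices of the neighbours `X_b` of `X_i` such that the normal `h_{i,b}` points out of `X_i`. -/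
def outNbrs (i : P.Cell) : Finset P.Cell := Finset.univ.filter fun b => P.Neighbour i b

open Classical in
/-- Indices of the neighbours `X_a` of `X_i` such that the normal `h_{a,i}` points into `X_i`. -/
def inNbrs (i : P.Cell) : Finset P.Cell := Finset.univ.filter fun a => P.Neighbour a i

/-- The Liouville operator `(ℒ v)(t, x, u) = ∂v/∂t + ∇ₓv · f(t, x, u)` on polynomials
`v ∈ ℝ[t, x]`. -/
def liouville (v : MvPolynomial (Option (Fin n)) ℝ) (t : ℝ) (x : Fin n → ℝ) (u : Fin m → ℝ) : ℝ :=
  MvPolynomial.eval (timeState t x) (MvPolynomial.pderiv none v) +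
    ∑ j, MvPolynomial.eval (timeState t x) (MvPolynomial.pderiv (some j) v) * P.f t x u j

/-- Feasibility for the infinite-dimensional LP on polynomials `w_i ∈ ℝ[x]`,
`v_{i,k} ∈ ℝ[t, x]`. -/
structure DualFeasible (w : P.Cell → MvPolynomial (Fin n) ℝ)
    (v : P.Cell → Fin (P.numTimes + 1) → MvPolynomial (Option (Fin n)) ℝ) : Prop where
  decrease : ∀ i k, ∀ t ∈ P.interval k, ∀ x ∈ P.subset i, ∀ u ∈ P.U,
    P.liouville (v i k) t x u ≤ 0
  initial : ∀ i, ∀ x ∈ P.subset i,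
    MvPolynomial.eval x (w i) ≥ MvPolynomial.eval (timeState 0 x) (v i 0) + 1
  terminal : ∀ i, ∀ x ∈ P.XT,
    MvPolynomial.eval (timeState P.T x) (v i (Fin.last _)) ≥ 0
  nonneg : ∀ i, ∀ x ∈ P.subset i, MvPolynomial.eval x (w i) ≥ 0
  time_jump : ∀ i, ∀ k : Fin P.numTimes, ∀ x ∈ P.subset i,
    MvPolynomial.eval (timeState (P.time k.castSucc.succ) x) (v i k.castSucc) ≥
      MvPolynomial.eval (timeState (P.time k.castSucc.succ) x) (v i k.succ)
  space_jump : ∀ a b, P.Neighbour a b → ∀ k, ∀ t ∈ P.interval k,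
    ∀ x ∈ P.subset a ∩ P.subset b, ∀ u ∈ P.U,
    (MvPolynomial.eval (timeState t x) (v a k) - MvPolynomial.eval (timeState t x) (v b k)) *
      P.flux a b t x u ≥ 0

/-- The optimal value `d_s` of the LP on polynomials, as an extended real number. -/
def dualValue : EReal :=
  ⨅ (w : P.Cell → MvPolynomial (Fin n) ℝ)
    (v : P.Cell → Fin (P.numTimes + 1) → MvPolynomial (Option (Fin n)) ℝ)
    (_ : P.DualFeasible w v),
    ((∑ i, ∫ x in P.subset i, MvPolynomial.eval x (w i) : ℝ) : EReal)

/-- `μ` is a finite positive Borel measure supported on the set `S`: `μ ∈ 𝓜(S)₊`. -/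
def SupportedOn {α : Type} [MeasurableSpace α] (μ : Measure α) (S : Set α) : Prop :=
  IsFiniteMeasure μ ∧ μ Sᶜ = 0

/-- Decision variables of the LP on measures. Only the values of `bdry k a b` at neighbours
`a`, `b` matter. -/
structure Measures where
  /-- `μ^i_k`, occupation measures -/
  occ : P.Cell → Fin (P.numTimes + 1) → Measure (ℝ × (Fin n → ℝ) × (Fin m → ℝ))
  /-- `μ^i_{T_k}`, measures at the time nodes -/
  node : P.Cell → Fin (P.numTimes + 2) → Measure (Fin n → ℝ)
  /-- `μ̂^i_0`, slack measures -/
  slack : P.Cell → Measure (Fin n → ℝ)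
  /-- `μ^{a∩b}_k`, boundary measures -/
  bdry : Fin (P.numTimes + 1) → P.Cell → P.Cell → Measure (ℝ × (Fin n → ℝ) × (Fin m → ℝ))

/-- Feasibility for the infinite-dimensional LP on measures; the Liouville equation
`-ℒ'μ^i_k + μ^i_{T_{k+1}} ⊗ δ_{T_{k+1}} - μ^i_{T_k} ⊗ δ_{T_k}
  + ∑_{b ∈ out} (h_{i,b}ᵀ f)' μ^{i∩b}_k - ∑_{a ∈ in} (h_{a,i}ᵀ f)' μ^{a∩i}_k = 0`
is tested with the polynomials `Ψ(t, x)`. -/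
structure PrimalFeasible (μ : P.Measures) : Prop where
  occ_supp : ∀ i k, SupportedOn (μ.occ i k) (P.interval k ×ˢ P.subset i ×ˢ P.U)
  node_supp : ∀ i, ∀ k : Fin (P.numTimes + 1), SupportedOn (μ.node i k.castSucc) (P.subset i)
  last_supp : ∀ i, SupportedOn (μ.node i (Fin.last _)) P.XT
  slack_supp : ∀ i, SupportedOn (μ.slack i) (P.subset i)
  bdry_supp : ∀ k a b, P.Neighbour a b →
    SupportedOn (μ.bdry k a b) (P.interval k ×ˢ (P.subset a ∩ P.subset b) ×ˢ P.U)
  initial : ∀ i, μ.node i 0 + μ.slack i = volume.restrict (P.subset i)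
  liouville_eq : ∀ i k, ∀ Ψ : MvPolynomial (Option (Fin n)) ℝ,
    -(∫ z, P.liouville Ψ z.1 z.2.1 z.2.2 ∂(μ.occ i k))
      + (∫ x, MvPolynomial.eval (timeState (P.time k.succ) x) Ψ ∂(μ.node i k.succ))
      - (∫ x, MvPolynomial.eval (timeState (P.time k.castSucc) x) Ψ ∂(μ.node i k.castSucc))
      + (∑ b ∈ P.outNbrs i, ∫ z, P.flux i b z.1 z.2.1 z.2.2 *
          MvPolynomial.eval (timeState z.1 z.2.1) Ψ ∂(μ.bdry k i b))
      - (∑ a ∈ P.inNbrs i, ∫ z, P.flux a i z.1 z.2.1 z.2.2 *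
          MvPolynomial.eval (timeState z.1 z.2.1) Ψ ∂(μ.bdry k a i)) = 0

/-- The optimal value `p_s` of the LP on measures, as an extended real number. -/
def primalValue : EReal :=
  ⨆ (μ : P.Measures) (_ : P.PrimalFeasible μ),
    ((∑ i, ∫ _x in P.subset i, (1 : ℝ) ∂(μ.node i 0) : ℝ) : EReal)

/-- The flow crosses the splits transversally: `h_{a,b}ᵀ f` does not vanish on `X_a ∩ X_b`, for
any pair of neighbours, any time and any admissible control. -/
def FluxNonzero : Prop :=
  ∀ a b, P.Neighbour a b → ∀ t ∈ Icc 0 P.T, ∀ x ∈ P.subset a ∩ P.subset b, ∀ u ∈ P.U,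
    P.flux a b t x u ≠ 0

end SplitROA

end

/-! ### Measures on compact sets: Riesz representation and determination by polynomials -/

noncomputable section

/-! Weak duality (`sum_measure_le_of_feasible`) comes from testing the Liouville equations with the
`v i k` and summing by parts: every dual constraint appears integrated against its own measure.

Strong duality rests on a Slater point of the dual LP. The delicate constraints are the jumps
between cells, where `v a k - v b k` needs the sign of the flux. Fix a control `u₀` and give cell
`i` the polynomial `-∑ j, i j * f j (0, x, u₀)`. Neighbouring indices differ by the normal vector,
so the jump from `a` to `b` is exactly the flux at `(0, x, u₀)`. For fixed `x` the flux is
continuous and nonvanishing on the connected set `[0, T] × U`, so it has the same sign at every `(t,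
u)`. The other constraints become strict after adding functions of `t` and `k` that are the same for
all cells, which leaves the jumps intact (`exists_dualStrictlyFeasible`).

With a Slater point, Hahn–Banach separation in a finite product of spaces of continuous functions on
compact sets produces a positive multiplier (`exists_multiplier_of_strictly_feasible`), and Riesz
representation turns it into measures (`exists_measures_of_strictly_feasible`). Read through the
pairing `sum_integral_constraintFun`, the multiplier identity says that these measures are primal
feasible, with value at least the dual value (`exists_primalFeasible_of_le_dual`). -/

/-- The restriction to a subset of a function that is continuous there. -/
def restrictTo {Z : Type*} [TopologicalSpace Z] {K : Set Z} (g : Z → ℝ) (hg : ContinuousOn g K) :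
    C(K, ℝ) :=
  ⟨fun z => g z, continuousOn_iff_continuous_domRestrict.1 hg⟩

theorem integral_nonneg_of_nonneg_on {Z : Type*} [MeasurableSpace Z] {K : Set Z} {μ : Measure Z} (hμ : μ Kᶜ = 0) {g : Z → ℝ}
    (hg : ∀ z ∈ K, 0 ≤ g z) : 0 ≤ ∫ z, g z ∂μ := by
  refine integral_nonneg_of_ae ?_
  have h : ∀ᵐ z ∂μ, z ∈ K := hμ
  filter_upwards [h] with z hz using hg z hz

section Measures

variable {Z : Type*} [TopologicalSpace Z] [T2Space Z] [MeasurableSpace Z] [BorelSpace Z]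

/-- **Riesz representation** on a compact subset of a Hausdorff space. -/
theorem exists_measure_of_positive_functional {K : Set Z} (hK : IsCompact K)
    (Λ : C(K, ℝ) →ₗ[ℝ] ℝ) (hΛ : ∀ g : C(K, ℝ), (∀ z, 0 ≤ g z) → 0 ≤ Λ g) :
    ∃ μ : Measure Z, IsFiniteMeasure μ ∧ μ Kᶜ = 0 ∧
      ∀ (g : Z → ℝ) (hg : ContinuousOn g K), ∫ z, g z ∂μ = Λ (restrictTo g hg) := by
  have : CompactSpace K := isCompact_iff_compactSpace.1 hK
  -- On the compact space `K` every continuous function has compact support, so the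
  -- Riesz–Markov–Kakutani theorem applies; its measure on `K` is then pushed forward to `Z`.
  let Λ₀ : CompactlySupportedContinuousMap K ℝ →ₗ[ℝ] ℝ :=
    { toFun := fun g => Λ g.toContinuousMap
      map_add' := fun g g' => Λ.map_add g.toContinuousMap g'.toContinuousMap
      map_smul' := fun c g => Λ.map_smul c g.toContinuousMap }
  let Λ₁ : CompactlySupportedContinuousMap K ℝ →ₚ[ℝ] ℝ :=
    PositiveLinearMap.mk₀ Λ₀ fun g hg => hΛ g.toContinuousMap fun z => hg z
  refine ⟨(RealRMK.rieszMeasure Λ₁).map Subtype.val, inferInstance, ?_, fun g hg => ?_⟩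
  · rw [Measure.map_apply (by fun_prop) hK.measurableSet.compl]
    simp
  · rw [(MeasurableEmbedding.subtype_coe hK.measurableSet).integral_map]
    exact RealRMK.integral_rieszMeasure Λ₁
      ⟨restrictTo g hg, HasCompactSupport.of_compactSpace _⟩

theorem integrable_of_continuousOn_of_isCompact {K : Set Z} (hK : IsCompact K) {μ : Measure Z}
    [IsFiniteMeasure μ] (hμ : μ Kᶜ = 0) {g : Z → ℝ} (hg : ContinuousOn g K) :
    Integrable g μ := by
  have h : μ.restrict K = μ := Measure.restrict_eq_self_of_ae_mem hμ
  rw [← h]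
  exact hg.integrableOn_compact hK

end Measures

/-- Finite measures on a compact subset of `ℝⁿ` are determined by the integrals of polynomials. -/
theorem measure_eq_of_integral_eval_eq {n : ℕ} {K : Set (Fin n → ℝ)} (hK : IsCompact K)
    {μ ν : Measure (Fin n → ℝ)} [IsFiniteMeasure μ] [IsFiniteMeasure ν]
    (hμ : μ Kᶜ = 0) (hν : ν Kᶜ = 0)
    (h : ∀ p : MvPolynomial (Fin n) ℝ,
      ∫ x, MvPolynomial.eval x p ∂μ = ∫ x, MvPolynomial.eval x p ∂ν) : μ = ν := by
  refine ext_of_forall_integral_eq_of_IsFiniteMeasure fun F => ?_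
  let φ : MvPolynomial (Fin n) ℝ →ₐ[ℝ] C(Fin n → ℝ, ℝ) :=
    MvPolynomial.aeval fun j => ⟨fun x => x j, continuous_apply j⟩
  have hφ : ∀ p x, φ p x = MvPolynomial.eval x p := by
    intro p x
    induction p using MvPolynomial.induction_on with
    | C a => simp [φ]
    | add p q hp hq => simp [map_add, hp, hq]
    | mul_X p j hp => rw [map_mul, map_mul, ContinuousMap.mul_apply, hp]; simp [φ]
  have hsep : φ.range.SeparatesPoints := by
    intro x y hxy
    obtain ⟨j, hj⟩ := Function.ne_iff.1 hxy
    exact ⟨_, ⟨φ (MvPolynomial.X j), ⟨MvPolynomial.X j, rfl⟩, rfl⟩, by simpa [hφ] using hj⟩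
  -- Closeness on `K` alone controls the integrals, since `ρ` does not charge the complement;
  -- Stone–Weierstrass then supplies `p`.
  have key : ∀ (ρ : Measure (Fin n → ℝ)) [IsFiniteMeasure ρ], ρ Kᶜ = 0 → ∀ ε > 0,
      ∀ p : MvPolynomial (Fin n) ℝ, (∀ x ∈ K, ‖φ p x - F x‖ < ε) →
      |∫ x, MvPolynomial.eval x p ∂ρ - ∫ x, F x ∂ρ| ≤ ε * ρ.real univ := by
    intro ρ _ hρ ε _ p hp
    have hi : Integrable (fun x => MvPolynomial.eval x p) ρ :=
      integrable_of_continuousOn_of_isCompact hK hρ (MvPolynomial.continuous_eval p).continuousOn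
    rw [← integral_sub hi (F.integrable ρ)]
    refine norm_integral_le_of_norm_le_const (μ := ρ)
      (f := fun x => MvPolynomial.eval x p - F x) ?_
    have hae : ∀ᵐ x ∂ρ, x ∈ K := hρ
    filter_upwards [hae] with x hx
    simpa [hφ] using (hp x hx).le
  refine eq_of_forall_dist_le fun ε hε => ?_
  set M := μ.real univ + ν.real univ + 1 with hM
  have hM0 : 0 < M := by positivity
  obtain ⟨_, ⟨p, rfl⟩, hp⟩ :=
    ContinuousMap.exists_mem_subalgebra_near_continuous_of_isCompact_of_separatesPoints hsep
      F.toContinuousMap hK (div_pos hε hM0)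
  have h1 := key μ hμ _ (div_pos hε hM0) p hp
  have h2 := key ν hν _ (div_pos hε hM0) p hp
  rw [h p] at h1
  have h3 : ε / M * μ.real univ + ε / M * ν.real univ ≤ ε := by
    rw [← mul_add, div_mul_eq_mul_div, div_le_iff₀ hM0]
    nlinarith
  rw [Real.dist_eq]
  rw [abs_le] at *
  constructor <;> linarith

/-! ### Lagrange multipliers by separation -/

/-- **Lagrange multipliers.** A linear objective that is bounded below on the set of solutions of
a strictly feasible system of linear inequalities between continuous functions on compact spaces
is dominated by a positive combination of the constraints. -/
theorem exists_multiplier_of_strictly_feasible {V ι : Type*} [AddCommGroup V] [Module ℝ V]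
    [Fintype ι] {Y : ι → Type*} [∀ c, TopologicalSpace (Y c)] [∀ c, CompactSpace (Y c)]
    (A : V →ₗ[ℝ] ∀ c, C(Y c, ℝ)) (b : ∀ c, C(Y c, ℝ)) (J : V →ₗ[ℝ] ℝ) (d : ℝ)
    (hslater : ∃ y, ∀ c z, b c z < A y c z)
    (hd : ∀ y, (∀ c z, b c z ≤ A y c z) → d ≤ J y) :
    ∃ Λ : (∀ c, C(Y c, ℝ)) →ₗ[ℝ] ℝ, (∀ g, (∀ c z, 0 ≤ g c z) → 0 ≤ Λ g) ∧
      (∀ y, Λ (A y) = J y) ∧ d ≤ Λ b := by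
  -- A common point of `s` and `t` would be a feasible `y` with `J y < d`. Strict positivity is an
  -- open condition because the `Y c` are compact and `ι` is finite.
  let s : Set ((∀ c, C(Y c, ℝ)) × ℝ) := {q | (∀ c z, 0 < q.1 c z) ∧ q.2 < 0}
  let t : Set ((∀ c, C(Y c, ℝ)) × ℝ) := range fun y => (A y - b, J y - d)
  have hs : Convex ℝ s := by
    rintro q ⟨hq, hq'⟩ r ⟨hr, hr'⟩ α β hα hβ hαβ
    refine ⟨fun c z => ?_, ?_⟩
    · have h1 := hq c z
      have h2 := hr c z
      change 0 < α * q.1 c z + β * r.1 c z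
      rcases hα.eq_or_lt with rfl | h
      · have : β = 1 := by linarith
        simpa [this] using h2
      · have := mul_pos h h1
        have := mul_nonneg hβ h2.le
        linarith
    · change α * q.2 + β * r.2 < 0
      rcases hα.eq_or_lt with rfl | h
      · have : β = 1 := by linarith
        simpa [this] using hr'
      · nlinarith [mul_pos_of_neg_of_neg hq' (neg_neg_of_pos h)]
  have hso : IsOpen s := by
    have : s = (⋂ c, {q | ∀ z, 0 < q.1 c z}) ∩ {q | q.2 < 0} := by
      ext q
      simp [s]
    rw [this]
    refine (isOpen_iInter_of_finite fun c => ?_).inter (isOpen_lt continuous_snd continuous_const)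
    have h1 : IsOpen {g : C(Y c, ℝ) | MapsTo g univ (Ioi 0)} :=
      ContinuousMap.isOpen_setOfPred_mapsTo isCompact_univ isOpen_Ioi
    have h2 : Continuous fun q : (∀ c, C(Y c, ℝ)) × ℝ => q.1 c := by fun_prop
    convert h1.preimage h2 using 1
    ext q
    simp [MapsTo]
  have ht : Convex ℝ t := by
    rintro _ ⟨y, rfl⟩ _ ⟨y', rfl⟩ α β _ _ hαβ
    refine ⟨α • y + β • y', ?_⟩
    have hb : b = α • b + β • b := by rw [← add_smul, hαβ, one_smul]
    have hd : d = α * d + β * d := by rw [← add_mul, hαβ, one_mul]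
    ext c z
    · have := congrArg (fun g : ∀ c, C(Y c, ℝ) => g c z) hb
      simp only [Pi.add_apply, Pi.smul_apply, ContinuousMap.add_apply, ContinuousMap.smul_apply,
        smul_eq_mul] at this
      simp only [map_add, map_smul, Prod.fst_add, Prod.smul_fst, Pi.add_apply, Pi.sub_apply,
        Pi.smul_apply, ContinuousMap.add_apply, ContinuousMap.sub_apply, ContinuousMap.smul_apply,
        smul_eq_mul]
      linarith
    · simp only [map_add, map_smul, Prod.snd_add, Prod.smul_snd, smul_eq_mul]
      linarith
  have hdisj : Disjoint s t := by
    rw [Set.disjoint_left]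
    rintro _ ⟨h1, h2⟩ ⟨y, rfl⟩
    have := hd y fun c z => by simpa using (h1 c z).le
    simp only at h2
    linarith
  obtain ⟨F, u, hF, hFt⟩ := geometric_hahn_banach_open hs hso ht hdisj
  -- `s` is stable under positive scaling: letting `r` grow forces `F ≤ 0` on `s`, and letting it
  -- shrink forces `0 ≤ u`.
  have hcone : ∀ q ∈ s, ∀ r > (0 : ℝ), r * F q < u := by
    intro q hq r hr
    have := hF (r • q) ⟨fun c z => mul_pos hr (hq.1 c z), mul_neg_of_pos_of_neg hr hq.2⟩
    simpa using this
  have hone : ((fun _ => 1 : ∀ c, C(Y c, ℝ)), (-1 : ℝ)) ∈ s := ⟨fun c z => by simp, by simp⟩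
  have hneg : ∀ q ∈ s, F q ≤ 0 := by
    intro q hq
    by_contra! h
    have h1 := hcone q hq ((|u| + 1) / F q) (by positivity)
    rw [div_mul_cancel₀ _ h.ne'] at h1
    linarith [le_abs_self u]
  have hu : 0 ≤ u := by
    by_contra! h
    have h0 := hneg _ hone
    have h1 := hcone _ hone (u / (2 * (F _ - 1)))
      (div_pos_of_neg_of_neg h (by linarith))
    rw [div_mul_eq_mul_div, div_lt_iff_of_neg (by linarith)] at h1
    nlinarith
  let Λ : (∀ c, C(Y c, ℝ)) →ₗ[ℝ] ℝ := F.toLinearMap ∘ₗ LinearMap.inl ℝ _ ℝ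
  let σ : ℝ := F (0, 1)
  have hFq : ∀ g r, F (g, r) = Λ g + r * σ := by
    intro g r
    have : (g, r) = (g, (0 : ℝ)) + r • ((0 : ∀ c, C(Y c, ℝ)), (1 : ℝ)) := by simp
    rw [this, map_add, map_smul]
    rfl
  have hpos : ∀ g : ∀ c, C(Y c, ℝ), (∀ c z, 0 < g c z) → ∀ r > 0, Λ g - r * σ ≤ 0 := by
    intro g hg r hr
    have := hneg (g, -r) ⟨hg, by simpa using hr⟩
    rw [hFq] at this
    linarith
  have hσ0 : 0 ≤ σ := by
    by_contra! h
    have h1 := hpos (fun _ => 1) (fun c z => by simp)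
      ((|Λ fun _ => 1| + 1) / (-σ)) (div_pos (by positivity) (by linarith))
    rw [div_mul_eq_mul_div, div_neg, mul_div_assoc, div_self h.ne] at h1
    linarith [neg_abs_le (Λ fun _ => 1)]
  -- Strict feasibility enters here. If `σ = 0`, then `F` ignores the last coordinate, and a Slater
  -- point gives a point of `s` and a point of `t` with the same value of `F`, against `F < u` on
  -- `s` and `u ≤ F` on `t`.
  have hσ : 0 < σ := by
    refine hσ0.lt_of_ne fun h => ?_
    obtain ⟨y, hy⟩ := hslater
    have h1 := hF (A y - b, -1) ⟨fun c z => by simpa using hy c z, by simp⟩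
    have h2 := hFt _ ⟨y, rfl⟩
    rw [hFq, ← h] at h1 h2
    linarith
  have hΛneg : ∀ g : ∀ c, C(Y c, ℝ), (∀ c z, 0 < g c z) → Λ g ≤ 0 := by
    intro g hg
    by_contra! h
    have := hpos g hg (Λ g / (2 * σ)) (by positivity)
    have h2 : Λ g / (2 * σ) * σ = Λ g / 2 := by field_simp
    linarith
  -- Perturb `g` by a positive constant, chosen so small that it lowers `Λ g` by at most half.
  have hΛ : ∀ g : ∀ c, C(Y c, ℝ), (∀ c z, 0 ≤ g c z) → Λ g ≤ 0 := by
    intro g hg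
    by_contra! h
    set e := Λ 1 with he
    have h1 := hΛneg (g + (Λ g / (2 * (|e| + 1))) • (1 : ∀ c, C(Y c, ℝ))) fun c z => by
      have h1 := hg c z
      change 0 < g c z + Λ g / (2 * (|e| + 1)) * 1
      positivity
    rw [map_add, map_smul, ← he, smul_eq_mul, div_mul_eq_mul_div] at h1
    have h2 : -(Λ g / 2) ≤ Λ g * e / (2 * (|e| + 1)) := by
      rw [le_div_iff₀ (by positivity)]
      nlinarith [neg_abs_le e]
    linarith
  have hmain : ∀ y, 0 ≤ Λ (A y) - Λ b + (J y - d) * σ := by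
    intro y
    have := hFt _ ⟨y, rfl⟩
    rw [hFq, map_sub] at this
    linarith
  -- By `hmain` this linear functional of `y` is bounded below, hence zero; otherwise the chosen
  -- multiple of `y` would make the right-hand side of `hmain` equal to `-1`.
  have hlin : ∀ y, Λ (A y) + J y * σ = 0 := by
    intro y
    by_contra h
    set e := Λ (A y) + J y * σ with he
    have h1 := hmain (((Λ b + d * σ - 1) / e) • y)
    rw [map_smul, map_smul, map_smul, smul_eq_mul, smul_eq_mul] at h1
    have h2 : (Λ b + d * σ - 1) / e * Λ (A y) + (Λ b + d * σ - 1) / e * J y * σ =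
        Λ b + d * σ - 1 := by
      rw [mul_assoc, ← mul_add, ← he, div_mul_cancel₀ _ h]
    linarith
  -- The separating functional is nonpositive on the positive cone, hence the sign; dividing by `σ`
  -- normalises the weight of the objective to one.
  refine ⟨(-σ⁻¹) • Λ, fun g hg => ?_, fun y => ?_, ?_⟩
  · have := mul_nonneg (inv_pos.2 hσ).le (neg_nonneg.2 (hΛ g hg))
    simpa using this
  · have h1 := hlin y
    rw [LinearMap.smul_apply, smul_eq_mul, neg_mul, ← mul_neg, inv_mul_eq_iff_eq_mul₀ hσ.ne']
    linarith
  · have h1 := hmain 0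
    rw [map_zero, map_zero, map_zero] at h1
    rw [LinearMap.smul_apply, smul_eq_mul, neg_mul, ← mul_neg, inv_mul_eq_div, le_div_iff₀ hσ]
    linarith

/-- Strong duality for a linear program with finitely many families of linear inequalities indexed
by compact sets: under strict feasibility the multipliers are finite measures. -/
theorem exists_measures_of_strictly_feasible {V ι Z : Type*} [AddCommGroup V] [Module ℝ V]
    [Fintype ι] [TopologicalSpace Z] [T2Space Z] [MeasurableSpace Z] [BorelSpace Z]
    {S : ι → Set Z} (hS : ∀ c, IsCompact (S c)) (A : V →ₗ[ℝ] ι → Z → ℝ)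
    (hA : ∀ y c, ContinuousOn (A y c) (S c)) (b : ι → Z → ℝ) (hb : ∀ c, ContinuousOn (b c) (S c))
    (J : V →ₗ[ℝ] ℝ) (d : ℝ) (hslater : ∃ y, ∀ c, ∀ z ∈ S c, b c z < A y c z)
    (hd : ∀ y, (∀ c, ∀ z ∈ S c, b c z ≤ A y c z) → d ≤ J y) :
    ∃ μ : ι → Measure Z, (∀ c, IsFiniteMeasure (μ c) ∧ μ c (S c)ᶜ = 0) ∧
      (∀ y, ∑ c, ∫ z, A y c z ∂(μ c) = J y) ∧ d ≤ ∑ c, ∫ z, b c z ∂(μ c) := by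
  classical
  have : ∀ c, CompactSpace (S c) := fun c => isCompact_iff_compactSpace.1 (hS c)
  let B : V →ₗ[ℝ] ∀ c, C(S c, ℝ) :=
    { toFun := fun y c => restrictTo (A y c) (hA y c)
      map_add' := fun y y' => by
        ext c z
        change A _ c z = _
        rw [map_add]
        rfl
      map_smul' := fun r y => by
        ext c z
        change A _ c z = _
        rw [map_smul]
        rfl }
  obtain ⟨Λ, hΛ, hJ, hdΛ⟩ := exists_multiplier_of_strictly_feasible B
    (fun c => restrictTo (b c) (hb c)) J d
    (hslater.imp fun y hy c z => hy c z z.2)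
    (fun y hy => hd y fun c z hz => hy c ⟨z, hz⟩)
  -- Restricting the multiplier to functions supported in the single factor `c` gives the functional
  -- represented by `μ c`.
  have hμ := fun c => exists_measure_of_positive_functional (hS c)
    (Λ ∘ₗ LinearMap.single ℝ (fun c => C(S c, ℝ)) c) fun g hg => hΛ _ fun c' z => by
      by_cases h : c' = c
      · subst h
        simpa using hg z
      · simp [h]
  choose μ hfin hsupp hint using hμ
  have hsum : ∀ (g : ι → Z → ℝ) (hg : ∀ c, ContinuousOn (g c) (S c)),
      ∑ c, ∫ z, g c z ∂(μ c) = Λ fun c => restrictTo (g c) (hg c) := by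
    intro g hg
    rw [Finset.sum_congr rfl fun c _ => hint c (g c) (hg c)]
    simp only [LinearMap.comp_apply, LinearMap.single_apply]
    rw [← map_sum, LinearMap.sum_single_apply]
  refine ⟨μ, fun c => ⟨hfin c, hsupp c⟩, fun y => ?_, ?_⟩
  · rw [hsum _ (hA y), ← hJ y]
    rfl
  · rwa [hsum _ hb]

/-! ### Compactness and continuity of the problem data -/

namespace SplitROA

variable {n m : ℕ} (P : SplitROA n m)

theorem isCompact_subset (hX : IsCompact P.X) (i : P.Cell) : IsCompact (P.subset i) := by
  have h : P.subset i = P.X ∩ ⋂ (j : Fin n) (p : Fin (P.numSplits j)),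
      {x | ((p : ℕ) < (i j : ℕ) → P.split j p ≤ x j) ∧ ((i j : ℕ) ≤ (p : ℕ) → x j ≤ P.split j p)} := by
    ext x
    simp only [subset, Set.mem_inter_iff, mem_iInter, mem_ofPred_eq]
  rw [h]
  refine hX.inter_right (isClosed_iInter fun j => isClosed_iInter fun p => ?_)
  refine IsClosed.inter ?_ ?_
  · exact isClosed_imp isOpen_const (isClosed_le continuous_const (continuous_apply j))
  · exact isClosed_imp isOpen_const (isClosed_le (continuous_apply j) continuous_const)

theorem time_nonneg (k : Fin (P.numTimes + 2)) : 0 ≤ P.time k :=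
  P.time_zero ▸ P.time_mono (Fin.zero_le k)

theorem time_le (k : Fin (P.numTimes + 2)) : P.time k ≤ P.T :=
  P.time_last ▸ P.time_mono (Fin.le_last k)

theorem interval_subset (k : Fin (P.numTimes + 1)) : P.interval k ⊆ Icc 0 P.T :=
  Icc_subset_Icc (P.time_nonneg _) (P.time_le _)

/-- The set `[T_k, T_{k+1}] × W × U`. -/
def cylinder (k : Fin (P.numTimes + 1)) (W : Set (Fin n → ℝ)) :
    Set (ℝ × (Fin n → ℝ) × (Fin m → ℝ)) :=
  P.interval k ×ˢ W ×ˢ P.U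

theorem isCompact_cylinder (hU : IsCompact P.U) (k : Fin (P.numTimes + 1)) {W : Set (Fin n → ℝ)}
    (hW : IsCompact W) : IsCompact (P.cylinder k W) :=
  isCompact_Icc.prod (hW.prod hU)

theorem cylinder_subset (k : Fin (P.numTimes + 1)) (W : Set (Fin n → ℝ)) :
    P.cylinder k W ⊆ Icc 0 P.T ×ˢ univ :=
  prod_mono (P.interval_subset k) (subset_univ _)

theorem continuous_timeState :
    Continuous fun z : ℝ × (Fin n → ℝ) => timeState z.1 z.2 := by
  refine continuous_pi fun o => ?_
  cases o with
  | none => exact continuous_fst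
  | some j => exact (continuous_apply j).comp continuous_snd

theorem continuous_eval_timeState (v : MvPolynomial (Option (Fin n)) ℝ) :
    Continuous fun z : ℝ × (Fin n → ℝ) => MvPolynomial.eval (timeState z.1 z.2) v :=
  (MvPolynomial.continuous_eval v).comp continuous_timeState

theorem continuous_eval_timeState_cylinder (v : MvPolynomial (Option (Fin n)) ℝ) :
    Continuous fun z : ℝ × (Fin n → ℝ) × (Fin m → ℝ) =>
      MvPolynomial.eval (timeState z.1 z.2.1) v :=
  (continuous_eval_timeState v).comp
    (f := fun z : ℝ × (Fin n → ℝ) × (Fin m → ℝ) => (z.1, z.2.1)) (by fun_prop)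

theorem continuous_eval_timeState_right (t : ℝ) (v : MvPolynomial (Option (Fin n)) ℝ) :
    Continuous fun x : Fin n → ℝ => MvPolynomial.eval (timeState t x) v :=
  (continuous_eval_timeState v).comp (f := fun x : Fin n → ℝ => (t, x)) (by fun_prop)

theorem continuousOn_f (j : Fin n) :
    ContinuousOn (fun z : ℝ × (Fin n → ℝ) × (Fin m → ℝ) => P.f z.1 z.2.1 z.2.2 j)
      (Icc 0 P.T ×ˢ univ) :=
  (continuous_apply j).comp_continuousOn P.f_cont

theorem continuousOn_liouville (v : MvPolynomial (Option (Fin n)) ℝ) :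
    ContinuousOn (fun z : ℝ × (Fin n → ℝ) × (Fin m → ℝ) => P.liouville v z.1 z.2.1 z.2.2)
      (Icc 0 P.T ×ˢ univ) :=
  (continuous_eval_timeState_cylinder _).continuousOn.add
    (continuousOn_finsetSum _ fun j _ =>
      (continuous_eval_timeState_cylinder _).continuousOn.mul (P.continuousOn_f j))

theorem continuousOn_flux (a b : P.Cell) :
    ContinuousOn (fun z : ℝ × (Fin n → ℝ) × (Fin m → ℝ) => P.flux a b z.1 z.2.1 z.2.2)
      (Icc 0 P.T ×ˢ univ) :=
  continuousOn_finsetSum _ fun j _ => continuousOn_const.mul (P.continuousOn_f j)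

/-! ### Summation by parts and weak duality -/

/-- The left-hand side of the Liouville equation on the cell `i` and the `k`-th time interval,
tested with `Ψ`. -/
def liouvilleDefect (μ : P.Measures) (i : P.Cell) (k : Fin (P.numTimes + 1))
    (Ψ : MvPolynomial (Option (Fin n)) ℝ) : ℝ :=
  -(∫ z, P.liouville Ψ z.1 z.2.1 z.2.2 ∂(μ.occ i k))
    + (∫ x, MvPolynomial.eval (timeState (P.time k.succ) x) Ψ ∂(μ.node i k.succ))
    - (∫ x, MvPolynomial.eval (timeState (P.time k.castSucc) x) Ψ ∂(μ.node i k.castSucc))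
    + (∑ b ∈ P.outNbrs i, ∫ z, P.flux i b z.1 z.2.1 z.2.2 *
        MvPolynomial.eval (timeState z.1 z.2.1) Ψ ∂(μ.bdry k i b))
    - (∑ a ∈ P.inNbrs i, ∫ z, P.flux a i z.1 z.2.1 z.2.2 *
        MvPolynomial.eval (timeState z.1 z.2.1) Ψ ∂(μ.bdry k a i))

/-- Summation by parts over the time nodes. -/
theorem sum_node_integrals (hX : IsCompact P.X) (ν : Fin (P.numTimes + 2) → Measure (Fin n → ℝ))
    (i : P.Cell)
    (hν : ∀ k : Fin (P.numTimes + 1), SupportedOn (ν k.castSucc) (P.subset i))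
    (v : Fin (P.numTimes + 1) → MvPolynomial (Option (Fin n)) ℝ) :
    ∑ k : Fin (P.numTimes + 1),
      ((∫ x, MvPolynomial.eval (timeState (P.time k.succ) x) (v k) ∂(ν k.succ))
        - ∫ x, MvPolynomial.eval (timeState (P.time k.castSucc) x) (v k) ∂(ν k.castSucc)) =
    (∫ x, MvPolynomial.eval (timeState P.T x) (v (Fin.last _)) ∂(ν (Fin.last _)))
      + (∑ k : Fin P.numTimes, ∫ x,
          (MvPolynomial.eval (timeState (P.time k.castSucc.succ) x) (v k.castSucc)
            - MvPolynomial.eval (timeState (P.time k.castSucc.succ) x) (v k.succ))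
          ∂(ν k.castSucc.succ))
      - ∫ x, MvPolynomial.eval (timeState 0 x) (v 0) ∂(ν 0) := by
  have hint : ∀ (k : Fin (P.numTimes + 1)) t Ψ,
      Integrable (fun x => MvPolynomial.eval (timeState t x) Ψ) (ν k.castSucc) := by
    intro k t Ψ
    have := (hν k).1
    exact integrable_of_continuousOn_of_isCompact (P.isCompact_subset hX i) (hν k).2
      (continuous_eval_timeState_right t Ψ).continuousOn
  rw [Finset.sum_sub_distrib, Fin.sum_univ_castSucc, Fin.sum_univ_succ (n := P.numTimes)]
  -- At an interior node the end of interval `k.castSucc` meets the start of interval `k.succ`; the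
  -- indices `k.castSucc.succ` and `k.succ.castSucc` agree definitionally.
  have h : ∀ k : Fin P.numTimes, ∫ x,
      (MvPolynomial.eval (timeState (P.time k.castSucc.succ) x) (v k.castSucc)
        - MvPolynomial.eval (timeState (P.time k.castSucc.succ) x) (v k.succ))
      ∂(ν k.castSucc.succ) =
      (∫ x, MvPolynomial.eval (timeState (P.time k.castSucc.succ) x) (v k.castSucc)
        ∂(ν k.castSucc.succ)) -
      ∫ x, MvPolynomial.eval (timeState (P.time k.succ.castSucc) x) (v k.succ)
        ∂(ν k.succ.castSucc) := fun k =>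
    integral_sub (hint k.succ _ _) (hint k.succ _ _)
  simp only [h, Finset.sum_sub_distrib, Fin.succ_last, P.time_last, Fin.castSucc_zero, P.time_zero]
  ring

open Classical in
/-- Regrouping of the boundary terms. -/
theorem sum_boundary_integrals (hX : IsCompact P.X) (hU : IsCompact P.U)
    (k : Fin (P.numTimes + 1)) (ν : P.Cell → P.Cell → Measure (ℝ × (Fin n → ℝ) × (Fin m → ℝ)))
    (hν : ∀ a b, P.Neighbour a b →
      SupportedOn (ν a b) (P.cylinder k (P.subset a ∩ P.subset b)))
    (v : P.Cell → MvPolynomial (Option (Fin n)) ℝ) :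
    ∑ i, ((∑ b ∈ P.outNbrs i, ∫ z, P.flux i b z.1 z.2.1 z.2.2 *
        MvPolynomial.eval (timeState z.1 z.2.1) (v i) ∂(ν i b))
      - ∑ a ∈ P.inNbrs i, ∫ z, P.flux a i z.1 z.2.1 z.2.2 *
        MvPolynomial.eval (timeState z.1 z.2.1) (v i) ∂(ν a i)) =
    ∑ a, ∑ b, if P.Neighbour a b then
      ∫ z, (MvPolynomial.eval (timeState z.1 z.2.1) (v a)
        - MvPolynomial.eval (timeState z.1 z.2.1) (v b)) * P.flux a b z.1 z.2.1 z.2.2 ∂(ν a b)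
      else 0 := by
  simp only [outNbrs, inNbrs, Finset.sum_filter]
  rw [Finset.sum_sub_distrib]
  -- Exchanging the sums in the incoming terms indexes both terms by the same ordered pair, hence by
  -- the same boundary measure.
  refine (congrArg₂ (· - ·) rfl Finset.sum_comm).trans ?_
  rw [← Finset.sum_sub_distrib]
  refine Finset.sum_congr rfl fun a _ => ?_
  rw [← Finset.sum_sub_distrib]
  refine Finset.sum_congr rfl fun b _ => ?_
  split_ifs with h
  · have := (hν a b h).1
    have hint : ∀ Ψ, Integrable (fun z : ℝ × (Fin n → ℝ) × (Fin m → ℝ) =>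
        P.flux a b z.1 z.2.1 z.2.2 * MvPolynomial.eval (timeState z.1 z.2.1) Ψ) (ν a b) := by
      intro Ψ
      refine integrable_of_continuousOn_of_isCompact
        (P.isCompact_cylinder hU k
          ((P.isCompact_subset hX a).inter_right (P.isCompact_subset hX b).isClosed))
        (hν a b h).2 ?_
      exact ((P.continuousOn_flux a b).mono (P.cylinder_subset k _)).mul
        (continuous_eval_timeState_cylinder Ψ).continuousOn
    rw [← integral_sub (hint _) (hint _)]
    refine integral_congr_ae (Filter.Eventually.of_forall fun z => ?_)
    ring
  · simp

open Classical in
/-- The pairing of the Liouville equations with polynomials `v_{i,k}`, expressed by the left-hand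
sides of the constraints of the dual problem. -/
theorem sum_liouvilleDefect (hX : IsCompact P.X) (hU : IsCompact P.U) (μ : P.Measures)
    (hnode : ∀ i, ∀ k : Fin (P.numTimes + 1), SupportedOn (μ.node i k.castSucc) (P.subset i))
    (hbdry : ∀ k a b, P.Neighbour a b →
      SupportedOn (μ.bdry k a b) (P.cylinder k (P.subset a ∩ P.subset b)))
    (v : P.Cell → Fin (P.numTimes + 1) → MvPolynomial (Option (Fin n)) ℝ) :
    ∑ i, ∑ k, P.liouvilleDefect μ i k (v i k) =
      (∑ i, ∑ k, ∫ z, -P.liouville (v i k) z.1 z.2.1 z.2.2 ∂(μ.occ i k))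
      + (∑ i, ∫ x, MvPolynomial.eval (timeState P.T x) (v i (Fin.last _))
          ∂(μ.node i (Fin.last _)))
      + (∑ i, ∑ k : Fin P.numTimes, ∫ x,
          (MvPolynomial.eval (timeState (P.time k.castSucc.succ) x) (v i k.castSucc)
            - MvPolynomial.eval (timeState (P.time k.castSucc.succ) x) (v i k.succ))
          ∂(μ.node i k.castSucc.succ))
      - (∑ i, ∫ x, MvPolynomial.eval (timeState 0 x) (v i 0) ∂(μ.node i 0))
      + ∑ a, ∑ b, ∑ k, if P.Neighbour a b then
          ∫ z, (MvPolynomial.eval (timeState z.1 z.2.1) (v a k)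
            - MvPolynomial.eval (timeState z.1 z.2.1) (v b k)) * P.flux a b z.1 z.2.1 z.2.2
            ∂(μ.bdry k a b)
          else 0 := by
  have h1 : ∀ i k, P.liouvilleDefect μ i k (v i k) =
      (∫ z, -P.liouville (v i k) z.1 z.2.1 z.2.2 ∂(μ.occ i k)) +
      ((∫ x, MvPolynomial.eval (timeState (P.time k.succ) x) (v i k) ∂(μ.node i k.succ))
        - ∫ x, MvPolynomial.eval (timeState (P.time k.castSucc) x) (v i k)
            ∂(μ.node i k.castSucc)) +
      ((∑ b ∈ P.outNbrs i, ∫ z, P.flux i b z.1 z.2.1 z.2.2 *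
          MvPolynomial.eval (timeState z.1 z.2.1) (v i k) ∂(μ.bdry k i b))
        - ∑ a ∈ P.inNbrs i, ∫ z, P.flux a i z.1 z.2.1 z.2.2 *
          MvPolynomial.eval (timeState z.1 z.2.1) (v i k) ∂(μ.bdry k a i)) := by
    intro i k
    rw [liouvilleDefect, integral_neg]
    ring
  simp only [h1]
  simp only [Finset.sum_add_distrib]
  have h2 := Finset.sum_congr (rfl : (Finset.univ : Finset P.Cell) = Finset.univ) fun i _ =>
    P.sum_node_integrals hX (μ.node i) i (hnode i) (v i)
  have h3 := Finset.sum_congr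
    (rfl : (Finset.univ : Finset (Fin (P.numTimes + 1))) = Finset.univ) fun k _ =>
    P.sum_boundary_integrals hX hU k (μ.bdry k) (hbdry k) fun i => v i k
  rw [Finset.sum_sub_distrib, Finset.sum_add_distrib] at h2
  rw [h2]
  refine congrArg₂ (· + ·) (by ring) (Finset.sum_comm.trans (h3.trans (Finset.sum_comm.trans ?_)))
  exact Finset.sum_congr rfl fun a _ => Finset.sum_comm

/-- Weak duality. The paired Liouville equations express `∑ i, ∫ v i 0 (0, ·)` against the initial
measures as a sum of nonnegative terms. Integrating `w ≥ v + 1` against the initial measure and `w ≥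
0` against the slack, which together make up Lebesgue measure, finishes. -/
theorem sum_measure_le_of_feasible (hX : IsCompact P.X) (hU : IsCompact P.U)
    {μ : P.Measures} (hμ : P.PrimalFeasible μ) {w : P.Cell → MvPolynomial (Fin n) ℝ}
    {v : P.Cell → Fin (P.numTimes + 1) → MvPolynomial (Option (Fin n)) ℝ}
    (hv : P.DualFeasible w v) :
    ∑ i, ∫ _x in P.subset i, (1 : ℝ) ∂(μ.node i 0) ≤
      ∑ i, ∫ x in P.subset i, MvPolynomial.eval x (w i) := by
  classical
  have hsum := P.sum_liouvilleDefect hX hU μ hμ.node_supp hμ.bdry_supp v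
  have hzero : ∑ i, ∑ k, P.liouvilleDefect μ i k (v i k) = 0 :=
    Finset.sum_eq_zero fun i _ => Finset.sum_eq_zero fun k _ => hμ.liouville_eq i k (v i k)
  rw [hzero] at hsum
  have h1 : 0 ≤ ∑ i, ∑ k, ∫ z, -P.liouville (v i k) z.1 z.2.1 z.2.2 ∂(μ.occ i k) :=
    Finset.sum_nonneg fun i _ => Finset.sum_nonneg fun k _ =>
      integral_nonneg_of_nonneg_on (hμ.occ_supp i k).2 fun z hz =>
        neg_nonneg.2 (hv.decrease i k z.1 hz.1 z.2.1 hz.2.1 z.2.2 hz.2.2)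
  have h2 : 0 ≤ ∑ i, ∫ x, MvPolynomial.eval (timeState P.T x) (v i (Fin.last _))
      ∂(μ.node i (Fin.last _)) :=
    Finset.sum_nonneg fun i _ =>
      integral_nonneg_of_nonneg_on (hμ.last_supp i).2 fun x hx => hv.terminal i x hx
  have h3 : 0 ≤ ∑ i, ∑ k : Fin P.numTimes, ∫ x,
      (MvPolynomial.eval (timeState (P.time k.castSucc.succ) x) (v i k.castSucc)
        - MvPolynomial.eval (timeState (P.time k.castSucc.succ) x) (v i k.succ))
      ∂(μ.node i k.castSucc.succ) :=
    Finset.sum_nonneg fun i _ => Finset.sum_nonneg fun k _ =>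
      integral_nonneg_of_nonneg_on (hμ.node_supp i k.succ).2 fun x hx =>
        sub_nonneg.2 (hv.time_jump i k x hx)
  have h4 : 0 ≤ ∑ a, ∑ b, ∑ k, if P.Neighbour a b then
          ∫ z, (MvPolynomial.eval (timeState z.1 z.2.1) (v a k)
            - MvPolynomial.eval (timeState z.1 z.2.1) (v b k)) * P.flux a b z.1 z.2.1 z.2.2
            ∂(μ.bdry k a b)
          else 0 := by
    refine Finset.sum_nonneg fun a _ => Finset.sum_nonneg fun b _ => Finset.sum_nonneg fun k _ => ?_
    split_ifs with h
    · exact integral_nonneg_of_nonneg_on (hμ.bdry_supp k a b h).2 fun z hz =>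
        hv.space_jump a b h k z.1 hz.1 z.2.1 hz.2.1 z.2.2 hz.2.2
    · exact le_rfl
  have h5 : ∀ i, ∫ _x in P.subset i, (1 : ℝ) ∂(μ.node i 0) +
      ∫ x, MvPolynomial.eval (timeState 0 x) (v i 0) ∂(μ.node i 0) ≤
      ∫ x in P.subset i, MvPolynomial.eval x (w i) := by
    intro i
    have := (hμ.slack_supp i).1
    have hs : μ.node i 0 (P.subset i)ᶜ = 0 := (hμ.node_supp i 0).2
    have hs' := (hμ.slack_supp i).2
    have : IsFiniteMeasure (μ.node i 0) := (hμ.node_supp i 0).1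
    have hw := (MvPolynomial.continuous_eval (w i)).continuousOn (s := P.subset i)
    have hi : Integrable (fun x => MvPolynomial.eval (timeState 0 x) (v i 0)) (μ.node i 0) :=
      integrable_of_continuousOn_of_isCompact (P.isCompact_subset hX i) hs
        (continuous_eval_timeState_right _ _).continuousOn
    have hiw := integrable_of_continuousOn_of_isCompact (P.isCompact_subset hX i) hs hw
    have hiw' := integrable_of_continuousOn_of_isCompact (P.isCompact_subset hX i) hs' hw
    rw [← hμ.initial i, integral_add_measure hiw hiw',
      Measure.restrict_eq_self_of_ae_mem (show ∀ᵐ x ∂(μ.node i 0), x ∈ P.subset i from hs),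
      ← integral_add (integrable_const _) hi]
    have h6 := integral_nonneg_of_nonneg_on hs' fun x hx => hv.nonneg i x hx
    have h7 := integral_nonneg_of_nonneg_on hs
      (g := fun x => MvPolynomial.eval x (w i)
        - (1 + MvPolynomial.eval (timeState 0 x) (v i 0))) fun x hx => by
      have := hv.initial i x hx
      linarith
    rw [integral_sub hiw (show Integrable
      (fun x => 1 + MvPolynomial.eval (timeState 0 x) (v i 0)) _ from
        (integrable_const _).add hi)] at h7
    linarith
  have h8 := Finset.sum_le_sum fun i (_ : i ∈ Finset.univ) => h5 i
  rw [Finset.sum_add_distrib] at h8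
  linarith

end SplitROA

/-! ### A strictly feasible point of the dual LP -/

/-- Finitely many continuous functions on compact sets have a common upper bound. -/
theorem exists_common_upper_bound {ι Z : Type*} [Finite ι] [TopologicalSpace Z] {S : ι → Set Z}
    (hS : ∀ c, IsCompact (S c)) {g : ι → Z → ℝ} (hg : ∀ c, ContinuousOn (g c) (S c)) :
    ∃ C : ℝ, ∀ c, ∀ z ∈ S c, g c z < C := by
  have := Fintype.ofFinite ι
  choose B hB using fun c => (hS c).exists_bound_of_continuousOn (hg c)
  refine ⟨∑ c, |B c| + 1, fun c z hz => ?_⟩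
  have h1 := (le_abs_self _).trans ((hB c z hz).trans (le_abs_self _))
  have h2 := Finset.single_le_sum (f := fun c => |B c|) (fun c _ => abs_nonneg _)
    (Finset.mem_univ c)
  linarith

/-- A nonvanishing continuous function on a preconnected set does not change sign. -/
theorem IsPreconnected.mul_pos_of_ne_zero {Z : Type*} [TopologicalSpace Z] {s : Set Z}
    (hs : IsPreconnected s) {g : Z → ℝ} (hg : ContinuousOn g s) (h0 : ∀ z ∈ s, g z ≠ 0)
    {y z : Z} (hy : y ∈ s) (hz : z ∈ s) : 0 < g y * g z := by
  have key : ∀ y ∈ s, ∀ z ∈ s, g y < 0 → 0 < g z → False := fun y hy z hz h1 h2 => by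
    obtain ⟨x, hx, hx0⟩ := hs.intermediate_value hy hz hg ⟨h1.le, h2.le⟩
    exact h0 x hx hx0
  rcases lt_or_gt_of_ne (h0 y hy) with h1 | h1 <;> rcases lt_or_gt_of_ne (h0 z hz) with h2 | h2
  · exact mul_pos_of_neg_of_neg h1 h2
  · exact (key y hy z hz h1 h2).elim
  · exact (key z hz y hy h2 h1).elim
  · exact mul_pos h1 h2

namespace SplitROA

variable {n m : ℕ} (P : SplitROA n m)

/-- This makes the flux between neighbours a difference of a potential attached to the cells. -/
theorem normal_eq_sub {a b : P.Cell} (h : P.Neighbour a b) (l : Fin n) :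
    P.normal a b l = ((b l : ℕ) : ℝ) - ((a l : ℕ) : ℝ) := by
  obtain ⟨-, j, hj, hl⟩ := h
  by_cases hlj : l = j
  · subst hlj
    have : a l < b l := by
      rw [Fin.lt_def]
      omega
    simp [normal, this, hj]
  · simp [normal, hl l hlj]

/-- At a fixed time and control the vector field is given by polynomials in the state. -/
theorem exists_polynomial_f {t : ℝ} (ht : t ∈ Icc 0 P.T) (u : Fin m → ℝ) (j : Fin n) :
    ∃ q : MvPolynomial (Option (Fin n)) ℝ, ∀ s x,
      MvPolynomial.eval (timeState s x) q = P.f t x u j := by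
  obtain ⟨p, hp⟩ := P.f_poly t ht j
  -- Controls are replaced by the constants `u l`; the variable `none` does not occur, so the value
  -- is independent of `s`.
  refine ⟨MvPolynomial.bind₁
    (Sum.elim (fun l => MvPolynomial.X (some l)) fun l => MvPolynomial.C (u l)) p, fun s x => ?_⟩
  rw [hp, ← MvPolynomial.coe_aeval_eq_eval, RingHom.coe_coe, MvPolynomial.aeval_bind₁,
    ← MvPolynomial.coe_aeval_eq_eval, RingHom.coe_coe]
  congr 2
  ext l
  cases l <;> simp [timeState]

/-- Polynomials on the cells whose jumps have the sign of the normal component of the vector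
field. -/
theorem exists_polynomials_jump_pos (hUconn : IsPreconnected P.U) (hflux : P.FluxNonzero) :
    ∃ p : P.Cell → MvPolynomial (Option (Fin n)) ℝ, ∀ a b, P.Neighbour a b →
      ∀ t ∈ Icc 0 P.T, ∀ x ∈ P.subset a ∩ P.subset b, ∀ u ∈ P.U,
        0 < (MvPolynomial.eval (timeState t x) (p a) - MvPolynomial.eval (timeState t x) (p b)) *
          P.flux a b t x u := by
  rcases P.U.eq_empty_or_nonempty with hU | ⟨u₀, hu₀⟩
  · exact ⟨0, fun a b _ t _ x _ u hu => by simp [hU] at hu⟩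
  have h0 : (0 : ℝ) ∈ Icc 0 P.T := ⟨le_rfl, P.T_pos.le⟩
  choose q hq using P.exists_polynomial_f h0 u₀
  refine ⟨fun i => -∑ j, MvPolynomial.C ((i j : ℕ) : ℝ) * q j, fun a b hab t ht x hx u hu => ?_⟩
  have h1 : MvPolynomial.eval (timeState t x) (-∑ j, MvPolynomial.C ((a j : ℕ) : ℝ) * q j) -
      MvPolynomial.eval (timeState t x) (-∑ j, MvPolynomial.C ((b j : ℕ) : ℝ) * q j) =
      P.flux a b 0 x u₀ := by
    simp only [map_neg, map_sum, map_mul, MvPolynomial.eval_C, hq, flux, P.normal_eq_sub hab]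
    rw [neg_sub_neg, ← Finset.sum_sub_distrib]
    exact Finset.sum_congr rfl fun j _ => by ring
  rw [h1]
  -- The point `x` stays fixed, so no connectedness of the interface is needed.
  have hconn : IsPreconnected (Icc 0 P.T ×ˢ P.U) := isPreconnected_Icc.prod hUconn
  have hcont : ContinuousOn (fun y : ℝ × (Fin m → ℝ) => P.flux a b y.1 x y.2)
      (Icc 0 P.T ×ˢ P.U) :=
    (P.continuousOn_flux a b).comp
      (f := fun y : ℝ × (Fin m → ℝ) => (y.1, x, y.2)) (by fun_prop)
      fun y hy => ⟨hy.1, mem_univ _⟩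
  exact hconn.mul_pos_of_ne_zero hcont (fun y hy => hflux a b hab y.1 hy.1 x hx y.2 hy.2)
    (y := (0, u₀)) (z := (t, u)) ⟨h0, hu₀⟩ ⟨ht, hu⟩

theorem liouville_add (v v' : MvPolynomial (Option (Fin n)) ℝ) (t : ℝ) (x : Fin n → ℝ)
    (u : Fin m → ℝ) : P.liouville (v + v') t x u = P.liouville v t x u + P.liouville v' t x u := by
  simp only [liouville, map_add, add_mul, Finset.sum_add_distrib]
  ring

theorem liouville_smul (c : ℝ) (v : MvPolynomial (Option (Fin n)) ℝ) (t : ℝ) (x : Fin n → ℝ)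
    (u : Fin m → ℝ) : P.liouville (c • v) t x u = c * P.liouville v t x u := by
  simp only [liouville, Derivation.map_smul, MvPolynomial.smul_eval, mul_add, Finset.mul_sum, mul_assoc]

theorem liouville_C (c : ℝ) (t : ℝ) (x : Fin n → ℝ) (u : Fin m → ℝ) :
    P.liouville (MvPolynomial.C c) t x u = 0 := by
  simp [liouville]

theorem liouville_time (t : ℝ) (x : Fin n → ℝ) (u : Fin m → ℝ) :
    P.liouville (MvPolynomial.X none) t x u = 1 := by
  simp [liouville, MvPolynomial.pderiv_X]

/-- The constraints of the dual problem, with strict inequalities. -/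
structure DualStrictlyFeasible (w : P.Cell → MvPolynomial (Fin n) ℝ)
    (v : P.Cell → Fin (P.numTimes + 1) → MvPolynomial (Option (Fin n)) ℝ) : Prop where
  decrease : ∀ i k, ∀ t ∈ P.interval k, ∀ x ∈ P.subset i, ∀ u ∈ P.U,
    P.liouville (v i k) t x u < 0
  initial : ∀ i, ∀ x ∈ P.subset i,
    MvPolynomial.eval (timeState 0 x) (v i 0) + 1 < MvPolynomial.eval x (w i)
  terminal : ∀ i, ∀ x ∈ P.XT, 0 < MvPolynomial.eval (timeState P.T x) (v i (Fin.last _))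
  nonneg : ∀ i, ∀ x ∈ P.subset i, 0 < MvPolynomial.eval x (w i)
  time_jump : ∀ i, ∀ k : Fin P.numTimes, ∀ x ∈ P.subset i,
    MvPolynomial.eval (timeState (P.time k.castSucc.succ) x) (v i k.succ) <
      MvPolynomial.eval (timeState (P.time k.castSucc.succ) x) (v i k.castSucc)
  space_jump : ∀ a b, P.Neighbour a b → ∀ k, ∀ t ∈ P.interval k,
    ∀ x ∈ P.subset a ∩ P.subset b, ∀ u ∈ P.U,
    0 < (MvPolynomial.eval (timeState t x) (v a k) - MvPolynomial.eval (timeState t x) (v b k)) *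
      P.flux a b t x u

/-- The jump polynomials settle the interfaces; every correction to `v` depends only on `t` and `k`,
so it cancels in the jumps. -/
theorem exists_dualStrictlyFeasible (hX : IsCompact P.X) (hU : IsCompact P.U)
    (hXT : IsCompact P.XT) (hUconn : IsPreconnected P.U) (hflux : P.FluxNonzero) :
    ∃ w v, P.DualStrictlyFeasible w v := by
  obtain ⟨p, hp⟩ := P.exists_polynomials_jump_pos hUconn hflux
  obtain ⟨C, hC⟩ := exists_common_upper_bound
    (fun c : P.Cell × Fin (P.numTimes + 1) =>
      P.isCompact_cylinder hU c.2 (P.isCompact_subset hX c.1))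
    (fun c => (P.continuousOn_liouville (p c.1)).mono (P.cylinder_subset _ _))
  obtain ⟨D, hD⟩ := exists_common_upper_bound (fun _ : P.Cell => hXT)
    (fun i => (continuous_eval_timeState_right P.T (-p i)).continuousOn)
  -- The term `-C t` lowers the Liouville derivative by `C`; `D + C T` makes the value at time `T`
  -- positive on `XT`; `numTimes - k` drops by one at each interior node and vanishes on the last
  -- interval.
  let v : P.Cell → Fin (P.numTimes + 1) → MvPolynomial (Option (Fin n)) ℝ := fun i k =>
    p i + (-C) • MvPolynomial.X none +
      MvPolynomial.C (D + C * P.T + ((P.numTimes : ℝ) - ((k : ℕ) : ℝ)))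
  have hv : ∀ i k t x, MvPolynomial.eval (timeState t x) (v i k) =
      MvPolynomial.eval (timeState t x) (p i) - C * t +
        (D + C * P.T + ((P.numTimes : ℝ) - ((k : ℕ) : ℝ))) := by
    intro i k t x
    simp [v, timeState, sub_eq_add_neg]
  obtain ⟨W, hW⟩ := exists_common_upper_bound (fun i : P.Cell => P.isCompact_subset hX i)
    (fun i => (continuous_eval_timeState_right 0 (v i 0)).continuousOn)
  refine ⟨fun _ => MvPolynomial.C (max W 0 + 1), v, ⟨?_, ?_, ?_, ?_, ?_, ?_⟩⟩
  · intro i k t ht x hx u hu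
    have := hC (i, k) (t, x, u) ⟨ht, hx, hu⟩
    rw [P.liouville_add, P.liouville_add, P.liouville_smul, P.liouville_C, P.liouville_time]
    simp only at this
    linarith
  · intro i x hx
    have := hW i x hx
    rw [MvPolynomial.eval_C]
    linarith [le_max_left W 0]
  · intro i x hx
    have := hD i x hx
    rw [map_neg] at this
    rw [hv, Fin.val_last]
    linarith
  · intro i x _
    rw [MvPolynomial.eval_C]
    linarith [le_max_right W 0]
  · intro i k x _
    rw [hv, hv, Fin.val_succ, Fin.val_castSucc]
    push_cast
    linarith
  · intro a b hab k t ht x hx u hu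
    have := hp a b hab t (P.interval_subset k ht) x hx u hu
    rw [hv, hv]
    convert this using 2
    ring

end SplitROA

/-! ### The dual LP as one system of inequalities on compact sets -/

namespace SplitROA

variable {n m : ℕ} (P : SplitROA n m)

/-- Indices of the constraints of the dual problem. The summands stand for the decrease along the
vector field, the initial condition, the terminal condition, the nonnegativity, the jumps in time
and the jumps in space. -/
abbrev ConstraintIndex : Type :=
  (P.Cell × Fin (P.numTimes + 1)) ⊕ P.Cell ⊕ P.Cell ⊕ P.Cell ⊕ (P.Cell × Fin P.numTimes) ⊕
    (P.Cell × P.Cell × Fin (P.numTimes + 1))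

/-- A set of states as a set of points `(t, x, u)` with `t = 0` and `u = 0`. -/
def slice (m : ℕ) {n : ℕ} (W : Set (Fin n → ℝ)) : Set (ℝ × (Fin n → ℝ) × (Fin m → ℝ)) :=
  {0} ×ˢ W ×ˢ {0}

/-- The common boundary of two neighbours; empty if the cells are not neighbours. -/
def interface (a b : P.Cell) : Set (Fin n → ℝ) :=
  {x | P.Neighbour a b ∧ x ∈ P.subset a ∩ P.subset b}

theorem isCompact_interface (hX : IsCompact P.X) (a b : P.Cell) :
    IsCompact (P.interface a b) := by
  by_cases h : P.Neighbour a b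
  · simpa [interface, h] using
      (P.isCompact_subset hX a).inter_right (P.isCompact_subset hX b).isClosed
  · simp [interface, h]

/-- The sets on which the constraints of the dual problem are imposed. -/
def constraintSet : P.ConstraintIndex → Set (ℝ × (Fin n → ℝ) × (Fin m → ℝ))
  | .inl (i, k) => P.cylinder k (P.subset i)
  | .inr (.inl i) => slice m (P.subset i)
  | .inr (.inr (.inl _)) => slice m P.XT
  | .inr (.inr (.inr (.inl i))) => slice m (P.subset i)
  | .inr (.inr (.inr (.inr (.inl (i, _))))) => slice m (P.subset i)
  | .inr (.inr (.inr (.inr (.inr (a, b, k))))) => P.cylinder k (P.interface a b)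

/-- The parts of the constraints of the dual problem that are linear in `(w, v)`. -/
def constraintFun (w : P.Cell → MvPolynomial (Fin n) ℝ)
    (v : P.Cell → Fin (P.numTimes + 1) → MvPolynomial (Option (Fin n)) ℝ) :
    P.ConstraintIndex → ℝ × (Fin n → ℝ) × (Fin m → ℝ) → ℝ
  | .inl (i, k) => fun z => -P.liouville (v i k) z.1 z.2.1 z.2.2
  | .inr (.inl i) => fun z =>
      MvPolynomial.eval z.2.1 (w i) - MvPolynomial.eval (timeState 0 z.2.1) (v i 0)
  | .inr (.inr (.inl i)) => fun z =>
      MvPolynomial.eval (timeState P.T z.2.1) (v i (Fin.last _))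
  | .inr (.inr (.inr (.inl i))) => fun z => MvPolynomial.eval z.2.1 (w i)
  | .inr (.inr (.inr (.inr (.inl (i, k))))) => fun z =>
      MvPolynomial.eval (timeState (P.time k.castSucc.succ) z.2.1) (v i k.castSucc) -
        MvPolynomial.eval (timeState (P.time k.castSucc.succ) z.2.1) (v i k.succ)
  | .inr (.inr (.inr (.inr (.inr (a, b, k))))) => fun z =>
      (MvPolynomial.eval (timeState z.1 z.2.1) (v a k) -
        MvPolynomial.eval (timeState z.1 z.2.1) (v b k)) * P.flux a b z.1 z.2.1 z.2.2

/-- The lower bounds of the constraints of the dual problem. -/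
def constraintBound : P.ConstraintIndex → ℝ
  | .inr (.inl _) => 1
  | _ => 0

theorem isCompact_constraintSet (hX : IsCompact P.X) (hU : IsCompact P.U) (hXT : IsCompact P.XT)
    (c : P.ConstraintIndex) : IsCompact (P.constraintSet c) := by
  have hslice : ∀ {W : Set (Fin n → ℝ)}, IsCompact W → IsCompact (slice m W) := fun hW =>
    isCompact_singleton.prod (hW.prod isCompact_singleton)
  rcases c with ⟨i, k⟩ | i | i | i | ⟨i, k⟩ | ⟨a, b, k⟩
  · exact P.isCompact_cylinder hU k (P.isCompact_subset hX i)
  · exact hslice (P.isCompact_subset hX i)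
  · exact hslice hXT
  · exact hslice (P.isCompact_subset hX i)
  · exact hslice (P.isCompact_subset hX i)
  · exact P.isCompact_cylinder hU k (P.isCompact_interface hX a b)

theorem continuous_state : Continuous fun z : ℝ × (Fin n → ℝ) × (Fin m → ℝ) => z.2.1 := by
  fun_prop

theorem continuousOn_constraintFun (w : P.Cell → MvPolynomial (Fin n) ℝ)
    (v : P.Cell → Fin (P.numTimes + 1) → MvPolynomial (Option (Fin n)) ℝ)
    (c : P.ConstraintIndex) : ContinuousOn (P.constraintFun w v c) (P.constraintSet c) := by
  have hw : ∀ p : MvPolynomial (Fin n) ℝ, Continuous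
      fun z : ℝ × (Fin n → ℝ) × (Fin m → ℝ) => MvPolynomial.eval z.2.1 p := fun p =>
    (MvPolynomial.continuous_eval p).comp continuous_state
  have hv : ∀ t (p : MvPolynomial (Option (Fin n)) ℝ), Continuous
      fun z : ℝ × (Fin n → ℝ) × (Fin m → ℝ) => MvPolynomial.eval (timeState t z.2.1) p :=
    fun t p => (continuous_eval_timeState_right t p).comp continuous_state
  rcases c with ⟨i, k⟩ | i | i | i | ⟨i, k⟩ | ⟨a, b, k⟩
  · exact ((P.continuousOn_liouville _).mono (P.cylinder_subset _ _)).neg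
  · exact ((hw _).sub (hv _ _)).continuousOn
  · exact (hv _ _).continuousOn
  · exact (hw _).continuousOn
  · exact ((hv _ _).sub (hv _ _)).continuousOn
  · exact ((continuous_eval_timeState_cylinder _).sub
      (continuous_eval_timeState_cylinder _)).continuousOn.mul
        ((P.continuousOn_flux a b).mono (P.cylinder_subset _ _))

/-- The linear map sending a decision variable of the dual problem to its constraint functions. -/
def constraintMap :
    ((P.Cell → MvPolynomial (Fin n) ℝ) ×
      (P.Cell → Fin (P.numTimes + 1) → MvPolynomial (Option (Fin n)) ℝ)) →ₗ[ℝ]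
    P.ConstraintIndex → ℝ × (Fin n → ℝ) × (Fin m → ℝ) → ℝ where
  toFun y := P.constraintFun y.1 y.2
  map_add' y y' := by
    ext c z
    rcases c with ⟨i, k⟩ | i | i | i | ⟨i, k⟩ | ⟨a, b, k⟩ <;>
      simp only [constraintFun, Prod.fst_add, Prod.snd_add, Pi.add_apply, map_add,
        P.liouville_add] <;> ring
  map_smul' r y := by
    ext c z
    rcases c with ⟨i, k⟩ | i | i | i | ⟨i, k⟩ | ⟨a, b, k⟩ <;>
      simp only [constraintFun, Prod.smul_fst, Prod.smul_snd, Pi.smul_apply,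
        MvPolynomial.smul_eval, P.liouville_smul, smul_eq_mul, RingHom.id_apply] <;> ring

theorem dualFeasible_of_constraints {w : P.Cell → MvPolynomial (Fin n) ℝ}
    {v : P.Cell → Fin (P.numTimes + 1) → MvPolynomial (Option (Fin n)) ℝ}
    (h : ∀ c, ∀ z ∈ P.constraintSet c, P.constraintBound c ≤ P.constraintFun w v c z) :
    P.DualFeasible w v where
  decrease i k t ht x hx u hu := neg_nonneg.1 (h (.inl (i, k)) (t, x, u) ⟨ht, hx, hu⟩)
  initial i x hx := by
    have := h (.inr (.inl i)) (0, x, 0) ⟨rfl, hx, rfl⟩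
    simp only [constraintBound, constraintFun] at this
    linarith
  terminal i x hx := h (.inr (.inr (.inl i))) (0, x, 0) ⟨rfl, hx, rfl⟩
  nonneg i x hx := h (.inr (.inr (.inr (.inl i)))) (0, x, 0) ⟨rfl, hx, rfl⟩
  time_jump i k x hx := sub_nonneg.1
    (h (.inr (.inr (.inr (.inr (.inl (i, k)))))) (0, x, 0) ⟨rfl, hx, rfl⟩)
  space_jump a b hab k t ht x hx u hu :=
    h (.inr (.inr (.inr (.inr (.inr (a, b, k)))))) (t, x, u) ⟨ht, ⟨hab, hx⟩, hu⟩

theorem DualStrictlyFeasible.constraints {P : SplitROA n m} {w : P.Cell → MvPolynomial (Fin n) ℝ}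
    {v : P.Cell → Fin (P.numTimes + 1) → MvPolynomial (Option (Fin n)) ℝ}
    (h : P.DualStrictlyFeasible w v) (c : P.ConstraintIndex) :
    ∀ z ∈ P.constraintSet c, P.constraintBound c < P.constraintFun w v c z := by
  intro z hz
  rcases c with ⟨i, k⟩ | i | i | i | ⟨i, k⟩ | ⟨a, b, k⟩
  · exact neg_pos.2 (h.decrease i k z.1 hz.1 z.2.1 hz.2.1 z.2.2 hz.2.2)
  · have := h.initial i z.2.1 hz.2.1
    simp only [constraintBound, constraintFun]
    linarith
  · exact h.terminal i z.2.1 hz.2.1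
  · exact h.nonneg i z.2.1 hz.2.1
  · exact sub_pos.2 (h.time_jump i k z.2.1 hz.2.1)
  · exact h.space_jump a b hz.2.1.1 k z.1 hz.1 z.2.1 hz.2.1.2 z.2.2 hz.2.2

theorem DualStrictlyFeasible.dualFeasible {P : SplitROA n m}
    {w : P.Cell → MvPolynomial (Fin n) ℝ}
    {v : P.Cell → Fin (P.numTimes + 1) → MvPolynomial (Option (Fin n)) ℝ}
    (h : P.DualStrictlyFeasible w v) : P.DualFeasible w v :=
  P.dualFeasible_of_constraints fun c z hz => (h.constraints c z hz).le

/-- The objective of the dual problem. -/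
def dualObjective (hX : IsCompact P.X) :
    ((P.Cell → MvPolynomial (Fin n) ℝ) ×
      (P.Cell → Fin (P.numTimes + 1) → MvPolynomial (Option (Fin n)) ℝ)) →ₗ[ℝ] ℝ where
  toFun y := ∑ i, ∫ x in P.subset i, MvPolynomial.eval x (y.1 i)
  map_add' y y' := by
    rw [← Finset.sum_add_distrib]
    refine Finset.sum_congr rfl fun i _ => ?_
    have hint : ∀ p : MvPolynomial (Fin n) ℝ,
        IntegrableOn (fun x => MvPolynomial.eval x p) (P.subset i) := fun p =>
      (MvPolynomial.continuous_eval p).continuousOn.integrableOn_compact (P.isCompact_subset hX i)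
    rw [← integral_add (hint _) (hint _)]
    simp only [Prod.fst_add, Pi.add_apply, map_add]
  map_smul' r y := by
    simp only [Prod.smul_fst, Pi.smul_apply, MvPolynomial.smul_eval, integral_const_mul,
      RingHom.id_apply, smul_eq_mul, Finset.mul_sum]

/-! ### Multipliers as primal variables -/

/-- The marginal on the state space. -/
def stateMarginal (ρ : Measure (ℝ × (Fin n → ℝ) × (Fin m → ℝ))) : Measure (Fin n → ℝ) :=
  ρ.map fun z => z.2.1

theorem integral_stateMarginal (ρ : Measure (ℝ × (Fin n → ℝ) × (Fin m → ℝ)))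
    {g : (Fin n → ℝ) → ℝ} (hg : Continuous g) :
    ∫ x, g x ∂(stateMarginal ρ) = ∫ z, g z.2.1 ∂ρ :=
  integral_map continuous_state.measurable.aemeasurable hg.aestronglyMeasurable

theorem supportedOn_stateMarginal {ρ : Measure (ℝ × (Fin n → ℝ) × (Fin m → ℝ))}
    {W : Set (Fin n → ℝ)} (hW : IsCompact W) (hρ : IsFiniteMeasure ρ ∧ ρ (slice m W)ᶜ = 0) :
    SupportedOn (stateMarginal ρ) W := by
  have := hρ.1
  refine ⟨by unfold stateMarginal; infer_instance, ?_⟩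
  rw [stateMarginal, Measure.map_apply continuous_state.measurable hW.measurableSet.compl]
  refine measure_mono_null (fun z hz => ?_) hρ.2
  exact fun hz' : z ∈ slice m W => hz hz'.2.1

/-- The decision variables of the primal problem given by multipliers of the constraints of the
dual problem. -/
def measuresOfMultipliers
    (ν : P.ConstraintIndex → Measure (ℝ × (Fin n → ℝ) × (Fin m → ℝ))) : P.Measures where
  occ i k := ν (.inl (i, k))
  -- Node `0` carries the multiplier of the initial condition, the last node that of the terminal
  -- condition, and each interior node that of its time jump.
  node i := Fin.cases (stateMarginal (ν (.inr (.inl i))))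
    (Fin.lastCases (stateMarginal (ν (.inr (.inr (.inl i)))))
      fun k => stateMarginal (ν (.inr (.inr (.inr (.inr (.inl (i, k))))))))
  slack i := stateMarginal (ν (.inr (.inr (.inr (.inl i)))))
  bdry k a b := ν (.inr (.inr (.inr (.inr (.inr (a, b, k))))))

section Multipliers

variable (ν : P.ConstraintIndex → Measure (ℝ × (Fin n → ℝ) × (Fin m → ℝ)))

theorem measuresOfMultipliers_node_last (i : P.Cell) :
    (P.measuresOfMultipliers ν).node i (Fin.last _) =
      stateMarginal (ν (.inr (.inr (.inl i)))) := by
  rw [← Fin.succ_last]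
  simp only [measuresOfMultipliers, Fin.cases_succ, Fin.lastCases_last]

theorem measuresOfMultipliers_node_succ (i : P.Cell) (k : Fin P.numTimes) :
    (P.measuresOfMultipliers ν).node i k.castSucc.succ =
      stateMarginal (ν (.inr (.inr (.inr (.inr (.inl (i, k))))))) := by
  simp only [measuresOfMultipliers, Fin.cases_succ, Fin.lastCases_castSucc]

variable {ν}

theorem supportedOn_node
    (hν : ∀ c, IsFiniteMeasure (ν c) ∧ ν c (P.constraintSet c)ᶜ = 0)
    (hX : IsCompact P.X) (i : P.Cell) (k : Fin (P.numTimes + 1)) :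
    SupportedOn ((P.measuresOfMultipliers ν).node i k.castSucc) (P.subset i) := by
  refine Fin.cases ?_ (fun k => ?_) k
  · exact supportedOn_stateMarginal (P.isCompact_subset hX i) (hν (.inr (.inl i)))
  · rw [← Fin.succ_castSucc, P.measuresOfMultipliers_node_succ]
    exact supportedOn_stateMarginal (P.isCompact_subset hX i)
      (hν (.inr (.inr (.inr (.inr (.inl (i, k)))))))

theorem supportedOn_bdry
    (hν : ∀ c, IsFiniteMeasure (ν c) ∧ ν c (P.constraintSet c)ᶜ = 0)
    (k : Fin (P.numTimes + 1)) (a b : P.Cell) :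
    SupportedOn ((P.measuresOfMultipliers ν).bdry k a b)
      (P.cylinder k (P.subset a ∩ P.subset b)) := by
  have h := hν (.inr (.inr (.inr (.inr (.inr (a, b, k))))))
  exact ⟨h.1, measure_mono_null
    (compl_subset_compl.2 (prod_mono le_rfl (prod_mono (fun x hx => hx.2) le_rfl))) h.2⟩

/-- The pairing of the multipliers with the constraints of the dual problem. -/
theorem sum_integral_constraintFun
    (hν : ∀ c, IsFiniteMeasure (ν c) ∧ ν c (P.constraintSet c)ᶜ = 0)
    (hX : IsCompact P.X) (hU : IsCompact P.U)
    (w : P.Cell → MvPolynomial (Fin n) ℝ)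
    (v : P.Cell → Fin (P.numTimes + 1) → MvPolynomial (Option (Fin n)) ℝ) :
    ∑ c, ∫ z, P.constraintFun w v c z ∂(ν c) =
      (∑ i, ((∫ x, MvPolynomial.eval x (w i) ∂((P.measuresOfMultipliers ν).node i 0))
        + ∫ x, MvPolynomial.eval x (w i) ∂((P.measuresOfMultipliers ν).slack i)))
      + ∑ i, ∑ k, P.liouvilleDefect (P.measuresOfMultipliers ν) i k (v i k) := by
  classical
  set μ := P.measuresOfMultipliers ν with hμ
  rw [P.sum_liouvilleDefect hX hU μ (P.supportedOn_node hν hX)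
    (fun k a b _ => P.supportedOn_bdry hν k a b) v]
  have h1 : ∀ i, ∫ z, P.constraintFun w v (.inr (.inl i)) z ∂(ν (.inr (.inl i))) =
      (∫ x, MvPolynomial.eval x (w i) ∂(μ.node i 0))
        - ∫ x, MvPolynomial.eval (timeState 0 x) (v i 0) ∂(μ.node i 0) := by
    intro i
    have hs : SupportedOn (μ.node i 0) (P.subset i) := P.supportedOn_node hν hX i 0
    have := hs.1
    have hc := P.isCompact_subset hX i
    have hw := MvPolynomial.continuous_eval (w i)
    have hv := continuous_eval_timeState_right 0 (v i 0)
    rw [← integral_sub (integrable_of_continuousOn_of_isCompact hc hs.2 hw.continuousOn)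
      (integrable_of_continuousOn_of_isCompact hc hs.2 hv.continuousOn)]
    exact (integral_stateMarginal _ (hw.sub hv)).symm
  have h2 : ∀ i, ∫ z, P.constraintFun w v (.inr (.inr (.inl i))) z ∂(ν (.inr (.inr (.inl i)))) =
      ∫ x, MvPolynomial.eval (timeState P.T x) (v i (Fin.last _)) ∂(μ.node i (Fin.last _)) := by
    intro i
    rw [hμ, P.measuresOfMultipliers_node_last, integral_stateMarginal _
      (continuous_eval_timeState_right _ _)]
    rfl
  have h3 : ∀ i, ∫ z, P.constraintFun w v (.inr (.inr (.inr (.inl i)))) z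
      ∂(ν (.inr (.inr (.inr (.inl i))))) = ∫ x, MvPolynomial.eval x (w i) ∂(μ.slack i) :=
    fun i => (integral_stateMarginal _ (MvPolynomial.continuous_eval (w i))).symm
  have h4 : ∀ i k, ∫ z, P.constraintFun w v (.inr (.inr (.inr (.inr (.inl (i, k)))))) z
      ∂(ν (.inr (.inr (.inr (.inr (.inl (i, k))))))) =
      ∫ x, (MvPolynomial.eval (timeState (P.time k.castSucc.succ) x) (v i k.castSucc)
        - MvPolynomial.eval (timeState (P.time k.castSucc.succ) x) (v i k.succ))
        ∂(μ.node i k.castSucc.succ) := by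
    intro i k
    rw [hμ, P.measuresOfMultipliers_node_succ]
    exact (integral_stateMarginal _ ((continuous_eval_timeState_right _ _).sub
      (continuous_eval_timeState_right _ _))).symm
  have h5 : ∀ a b k, ∫ z, P.constraintFun w v (.inr (.inr (.inr (.inr (.inr (a, b, k)))))) z
      ∂(ν (.inr (.inr (.inr (.inr (.inr (a, b, k))))))) =
      if P.Neighbour a b then
        ∫ z, (MvPolynomial.eval (timeState z.1 z.2.1) (v a k)
          - MvPolynomial.eval (timeState z.1 z.2.1) (v b k)) * P.flux a b z.1 z.2.1 z.2.2
          ∂(μ.bdry k a b)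
      else 0 := by
    intro a b k
    split_ifs with h
    · rfl
    -- For non-neighbours the constraint set is empty, so the multiplier is the zero measure.
    · have h0 := (hν (.inr (.inr (.inr (.inr (.inr (a, b, k))))))).2
      have hempty : P.constraintSet (.inr (.inr (.inr (.inr (.inr (a, b, k)))))) = ∅ := by
        simp [constraintSet, cylinder, interface, h]
      rw [hempty, compl_empty, Measure.measure_univ_eq_zero] at h0
      rw [h0, integral_zero_measure]
  have h6 : ∀ i k, ∫ z, P.constraintFun w v (.inl (i, k)) z ∂(ν (.inl (i, k))) =
      ∫ z, -P.liouville (v i k) z.1 z.2.1 z.2.2 ∂(μ.occ i k) := fun i k => rfl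
  simp only [Fintype.sum_sum_type, Fintype.sum_prod_type, h1, h2, h3, h4, h5, h6,
    Finset.sum_add_distrib, Finset.sum_sub_distrib]
  ring

end Multipliers

/-! ### Strong duality -/

theorem liouvilleDefect_zero (μ : P.Measures) (i : P.Cell) (k : Fin (P.numTimes + 1)) :
    P.liouvilleDefect μ i k 0 = 0 := by
  simp [liouvilleDefect, liouville]

/-- **Strong duality**: a lower bound of the dual problem is attained in the primal problem. -/
theorem exists_primalFeasible_of_le_dual (hX : IsCompact P.X) (hU : IsCompact P.U)
    (hXT : IsCompact P.XT) (hs : ∃ w v, P.DualStrictlyFeasible w v) (d : ℝ)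
    (hd : ∀ w v, P.DualFeasible w v → d ≤ ∑ i, ∫ x in P.subset i, MvPolynomial.eval x (w i)) :
    ∃ μ, P.PrimalFeasible μ ∧ d ≤ ∑ i, ∫ _x in P.subset i, (1 : ℝ) ∂(μ.node i 0) := by
  classical
  obtain ⟨ν, hν, hJ, hdν⟩ := exists_measures_of_strictly_feasible
    (P.isCompact_constraintSet hX hU hXT) P.constraintMap
    (fun y c => P.continuousOn_constraintFun y.1 y.2 c) (fun c _ => P.constraintBound c)
    (fun c => continuousOn_const) (P.dualObjective hX) d
    (by obtain ⟨w, v, h⟩ := hs; exact ⟨(w, v), h.constraints⟩)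
    (fun y hy => hd y.1 y.2 (P.dualFeasible_of_constraints hy))
  set μ := P.measuresOfMultipliers ν with hμ
  have hpair : ∀ (w : P.Cell → MvPolynomial (Fin n) ℝ)
      (v : P.Cell → Fin (P.numTimes + 1) → MvPolynomial (Option (Fin n)) ℝ),
      (∑ i, ((∫ x, MvPolynomial.eval x (w i) ∂(μ.node i 0))
        + ∫ x, MvPolynomial.eval x (w i) ∂(μ.slack i)))
      + ∑ i, ∑ k, P.liouvilleDefect μ i k (v i k) =
      ∑ i, ∫ x in P.subset i, MvPolynomial.eval x (w i) := fun w v =>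
    (P.sum_integral_constraintFun hν hX hU w v).symm.trans (hJ (w, v))
  have hnode := P.supportedOn_node hν hX
  have hslack : ∀ i, SupportedOn (μ.slack i) (P.subset i) := fun i =>
    supportedOn_stateMarginal (P.isCompact_subset hX i) (hν (.inr (.inr (.inr (.inl i)))))
  have hnode0 : ∀ i, SupportedOn (μ.node i 0) (P.subset i) := fun i => hnode i 0
  have hdefect : ∀ i k Ψ, P.liouvilleDefect μ i k Ψ = 0 := by
    intro i k Ψ
    -- The dual objective does not involve `v`, so testing with a single `v i k` isolates one
    -- Liouville equation.
    have h := hpair 0 (Pi.single i (Pi.single k Ψ))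
    simp only [Pi.zero_apply, map_zero, integral_zero, add_zero, zero_add,
      Finset.sum_const_zero] at h
    rw [Finset.sum_eq_single i, Finset.sum_eq_single k] at h
    · simpa using h
    · intro k' _ hk
      simp [hk, liouvilleDefect_zero]
    · simp
    · intro i' _ hi
      simp [hi, liouvilleDefect_zero]
    · simp
  have hinit : ∀ i, μ.node i 0 + μ.slack i = volume.restrict (P.subset i) := by
    intro i
    have hc := P.isCompact_subset hX i
    have := (hnode0 i).1
    have := (hslack i).1
    have : IsFiniteMeasure (volume.restrict (P.subset i)) :=
      ⟨by simpa using hc.measure_lt_top⟩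
    refine measure_eq_of_integral_eval_eq hc ?_ ?_ fun p => ?_
    · simp [(hnode0 i).2, (hslack i).2]
    · rw [Measure.restrict_apply hc.measurableSet.compl]
      simp
    · have hp := (MvPolynomial.continuous_eval p).continuousOn (s := P.subset i)
      rw [integral_add_measure
        (integrable_of_continuousOn_of_isCompact hc (hnode0 i).2 hp)
        (integrable_of_continuousOn_of_isCompact hc (hslack i).2 hp)]
      -- Testing with a single `w i` matches polynomial integrals, which determine measures on the
      -- compact cell.
      have h := hpair (Pi.single i p) 0
      rw [Finset.sum_eq_single i, Finset.sum_eq_single (a := i)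
        (f := fun i' => ∫ x in P.subset i', MvPolynomial.eval x
          ((Pi.single i p : P.Cell → MvPolynomial (Fin n) ℝ) i'))] at h
      · simpa [liouvilleDefect_zero] using h
      · intro i' _ hi
        simp [hi]
      · simp
      · intro i' _ hi
        simp [hi]
      · simp
  refine ⟨μ, ⟨fun i k => hν (.inl (i, k)), hnode, fun i => ?_, hslack,
    fun k a b _ => P.supportedOn_bdry hν k a b, hinit, hdefect⟩, hdν.trans_eq ?_⟩
  · rw [hμ, P.measuresOfMultipliers_node_last]
    exact supportedOn_stateMarginal hXT (hν (.inr (.inr (.inl i))))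
  -- The bound is `1` on the initial constraints and `0` elsewhere, so its pairing with the
  -- multipliers is the total initial mass.
  · simp only [Fintype.sum_sum_type, constraintBound, integral_zero, Finset.sum_const_zero,
      zero_add, add_zero]
    refine Finset.sum_congr rfl fun i _ => ?_
    rw [Measure.restrict_eq_self_of_ae_mem
      (show ∀ᵐ x ∂(μ.node i 0), x ∈ P.subset i from (hnode0 i).2)]
    exact (integral_stateMarginal _ continuous_const).symm

end SplitROA

end

theorem mainTheorem1 {n m : ℕ} (P : SplitROA n m)
    (hX : IsCompact P.X) (hU : IsCompact P.U) (hXT : IsCompact P.XT)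
    (hUconn : IsPreconnected P.U)
    (hflux : P.FluxNonzero) :
    P.dualValue = P.primalValue := by
  have hs := P.exists_dualStrictlyFeasible hX hU hXT hUconn hflux
  refine le_antisymm ?_ ?_
  -- The dual value is finite: `w ≥ 0` bounds it below and the Slater point bounds it above. It can
  -- thus serve as the real lower bound `d` in strong duality.
  · have hnonneg : ((0 : ℝ) : EReal) ≤ P.dualValue := by
      refine le_iInf fun w => le_iInf fun v => le_iInf fun h => EReal.coe_le_coe_iff.2 ?_
      exact Finset.sum_nonneg fun i _ =>
        setIntegral_nonneg (P.isCompact_subset hX i).measurableSet (h.nonneg i)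
    have hle : ∀ w v, P.DualFeasible w v → P.dualValue ≤
        ((∑ i, ∫ x in P.subset i, MvPolynomial.eval x (w i) : ℝ) : EReal) := fun w v h =>
      iInf_le_of_le w (iInf_le_of_le v (iInf_le_of_le h le_rfl))
    have htop : P.dualValue ≠ ⊤ := by
      obtain ⟨w, v, h⟩ := hs
      exact ((hle w v h.dualFeasible).trans_lt (EReal.coe_lt_top _)).ne
    have hbot : P.dualValue ≠ ⊥ := ((EReal.bot_lt_coe 0).trans_le hnonneg).ne'
    have hcoe := EReal.coe_toReal htop hbot
    obtain ⟨μ, hμ, hle'⟩ := P.exists_primalFeasible_of_le_dual hX hU hXT hs P.dualValue.toReal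
      fun w v h => EReal.coe_le_coe_iff.1 (hcoe.trans_le (hle w v h))
    rw [← hcoe]
    exact (EReal.coe_le_coe_iff.2 hle').trans (le_iSup_of_le μ (le_iSup_of_le hμ le_rfl))
  · refine iSup_le fun μ => iSup_le fun hμ => le_iInf fun w => le_iInf fun v => le_iInf fun hv => ?_
    exact EReal.coe_le_coe_iff.2 (P.sum_measure_le_of_feasible hX hU hμ hv)
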